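/- Let $m,D\ge 1$. A $D$-dimensional Haar-assembled ensemble is the law $\mathcal E$ of the random density matrix $$\sigma=\sum_{j=1}^J p_j\,U_j\bigl(\psi_1^{\otimes a_{j1}}\otimes\cdots\otimes\psi_m^{\otimes a_{jm}}\otimes\tau_j\bigr)U_j^\dagger ,$$ where $\psi_r=|\psi_r\rangle\langle\psi_r|$ for independent Haar-random (uniformly distributed) unit vectors $|\psi_r\rangle\in\mathbb C^{d_r}$, $d_r\ge1$, $r=1,\dots,m$; $(p_j)_{j=1}^J$ is a fixed probability distribution, $a_{jr}\in\mathbb N$, the $\tau_j$ are fixed density matrices and the $U_j$ fixed unitaries, with every term of dimension $D$. Put $$a_r=\sum_j p_j a_{jr},\qquad a'_r=\sum_j p_j a_{jr}^2,\qquad d_{\min}=\min_r d_r,\qquad a_{\max}=\max_r a_r .$$ Let $T\ge 1$. A $(D,T)$-product POVM is a POVM $M=\{F_s\}_s$ on $(\mathbb C^D)^{\otimes T}$ with finitely many outcomes, each $F_s$ being a tensor product of $T$ operators on $\mathbb C^D$; write $d_M(\rho_1,\rho_2)=\frac12\sum_s|\mathrm{tr}(F_s\rho_1)-\mathrm{tr}(F_s\rho_2)|$.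 A 1-replica $T$-round protocol measures one copy of the unknown state in each of $T$ rounds, by a POVM with finitely many outcomes that may depend on all earlier outcomes, and finally guesses (possibly at random) from all outcomes; its measurements form the POVM $\{F_{s_1}\otimes F_{s_1,s_2}\otimes\cdots\otimes F_{s_1,\dots,s_T}\}_{s_1,\dots,s_T}$. Its success probability is the probability of a correct guess when, with probability $\frac12$ each, all copies are copies of one $\sigma$ drawn from $\mathcal E$, or are copies of the average $\mathbb E[\sigma]$. Then: 1. For every $(D,T)$-product POVM $M$, $$d_M\bigl(\mathbb E[\sigma^{\otimes T}],(\mathbb E[\sigma])^{\otimes T}\bigr)\le T(T-1)\sum_{r=1}^m\frac{a_r^2}{d_r}+T\sum_{r=1}^m\frac{a'_r}{d_r}.$$ 2. The POVM $M$ of every 1-replica $T$-round protocol is a $(D,T)$-product POVM, and the protocol distinguishes $\mathcal E$ from $\mathbb E[\sigma]$ with success probability at most $\frac12+\frac12\,d_M\bigl(\mathbb E[\sigma^{\otimes T}],(\mathbb E[\sigma])^{\otimes T}\bigr)$. 3. Consequently $T=\Omega\bigl(\sqrt{d_{\min}/(m a_{\max}^2)}\bigr)$ is necessary for a constant success probability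 above $\frac12$: for every $\delta>0$ there is $c>0$, depending only on $\delta$, such that whenever a 1-replica $T$-round protocol distinguishes a Haar-assembled ensemble from its average with success probability at least $\frac12+\delta$, then $a_{\max}>0$ and $T\ge c\sqrt{d_{\min}/(m a_{\max}^2)}$. -/

import Mathlib

open MeasureTheory
open scoped Matrix Kronecker ComplexOrder

noncomputable section

namespace HaarAssembled

/-- The tensor product `⨂ i, A i` of a finite family of square matrices, acting on the tensor
product of the spaces `ℂ^(n i)`, whose standard basis is indexed by `∀ i, n i`. -/
def tensor {ι : Type*} [Fintype ι] {n : ι → Type*} (A : ∀ i, Matrix (n i) (n i) ℂ) :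
    Matrix (∀ i, n i) (∀ i, n i) ℂ :=
  Matrix.of fun x y => ∏ i, A i (x i) (y i)

/-- The tensor power `A^{⊗ T}`. -/
def tensorPow {n : Type*} (T : ℕ) (A : Matrix n n ℂ) :
    Matrix (Fin T → n) (Fin T → n) ℂ :=
  tensor fun _ : Fin T => A

/-- A density matrix: positive semidefinite with unit trace. -/
def IsState {n : Type*} [Fintype n] (ρ : Matrix n n ℂ) : Prop :=
  ρ.PosSemidef ∧ ρ.trace = 1

/-- Unit vectors of the Hilbert space `ℂ^d`. -/
abbrev Ket (d : ℕ) : Type := Metric.sphere (0 : EuclideanSpace ℂ (Fin d)) 1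

/-- The Haar (uniform) probability measure on the unit vectors of `ℂ^d`: the surface measure
of the unit sphere, normalised to total mass one. -/
def haarKet (d : ℕ) : Measure (Ket d) :=
  ((volume : Measure (EuclideanSpace ℂ (Fin d))).toSphere Set.univ)⁻¹ •
    (volume : Measure (EuclideanSpace ℂ (Fin d))).toSphere

/-- The rank-one density matrix `|ψ⟩⟨ψ|` of a unit vector. -/
def pureState {d : ℕ} (ψ : Ket d) : Matrix (Fin d) (Fin d) ℂ :=
  Matrix.of fun x y => (ψ : EuclideanSpace ℂ (Fin d)) x * star ((ψ : EuclideanSpace ℂ (Fin d)) y)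

/-- The data of a `D`-dimensional Haar-assembled ensemble assembled by `m` Haar-random states.
The tensor product `ψ_1^{⊗ a_{j1}} ⊗ ⋯ ⊗ ψ_m^{⊗ a_{jm}} ⊗ τ_j` acts on the space with standard
basis indexed by `(∀ r, Fin (a j r) → Fin (d r)) × Fin (e j)`. The unitary `U j` maps this space
onto `ℂ^D`; its two unitarity conditions force the dimension of each term to be `D`. -/
structure Ensemble (m D : ℕ) where
  m_pos : 0 < m
  /-- local dimensions of the Haar-random states -/
  d : Fin m → ℕ
  d_pos : ∀ r, 0 < d r
  /-- number of terms of the mixture -/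
  J : ℕ
  /-- weights of the mixture -/
  p : Fin J → ℝ
  p_nonneg : ∀ j, 0 ≤ p j
  p_sum : ∑ j, p j = 1
  /-- multiplicity of the `r`-th Haar-random state in the `j`-th term -/
  a : Fin J → Fin m → ℕ
  /-- dimension of the fixed state of the `j`-th term -/
  e : Fin J → ℕ
  /-- fixed states -/
  τ : ∀ j, Matrix (Fin (e j)) (Fin (e j)) ℂ
  τ_state : ∀ j, IsState (τ j)
  /-- fixed unitaries -/
  U : ∀ j, Matrix (Fin D) ((∀ r, Fin (a j r) → Fin (d r)) × Fin (e j)) ℂ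
  U_mul_conjTranspose : ∀ j, U j * (U j)ᴴ = 1
  conjTranspose_mul_U : ∀ j, (U j)ᴴ * U j = 1

namespace Ensemble

variable {m D : ℕ} (E : Ensemble m D)

/-- The joint law of the independent Haar-random states `ψ_1, …, ψ_m`. -/
def law : Measure (∀ r, Ket (E.d r)) := Measure.pi fun r => haarKet (E.d r)

/-- The element of the ensemble determined by `ψ_1, …, ψ_m`:
`∑ j, p_j U_j (ψ_1^{⊗ a_{j1}} ⊗ ⋯ ⊗ ψ_m^{⊗ a_{jm}} ⊗ τ_j) U_j†`. -/
def state (ψ : ∀ r, Ket (E.d r)) : Matrix (Fin D) (Fin D) ℂ :=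
  ∑ j, (E.p j : ℂ) •
    (E.U j * ((tensor fun r => tensorPow (E.a j r) (pureState (ψ r))) ⊗ₖ E.τ j) * (E.U j)ᴴ)

/-- The expectation `𝔼[σ]`, taken entrywise. -/
def mean : Matrix (Fin D) (Fin D) ℂ :=
  Matrix.of fun x y => ∫ ψ, E.state ψ x y ∂E.law

/-- The expectation `𝔼[σ^{⊗ T}]`, taken entrywise. -/
def moment (T : ℕ) : Matrix (Fin T → Fin D) (Fin T → Fin D) ℂ :=
  Matrix.of fun x y => ∫ ψ, tensorPow T (E.state ψ) x y ∂E.law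

/-- The average occurrence `a_r` of `ψ_r`. -/
def avg (r : Fin m) : ℝ := ∑ j, E.p j * (E.a j r : ℝ)

/-- The average squared occurrence `a'_r` of `ψ_r`. -/
def avgSq (r : Fin m) : ℝ := ∑ j, E.p j * (E.a j r : ℝ) ^ 2

/-- `d_min`, the least local dimension (a minimum over a nonempty finite set). -/
def dMin : ℕ := ⨅ r, E.d r

/-- `a_max`, the greatest average occurrence (a maximum over a nonempty finite set). -/
def aMax : ℝ := ⨆ r, E.avg r

end Ensemble

/-- A POVM with finitely many outcomes. -/
def IsPOVM {n S : Type*} [Fintype n] [DecidableEq n] [Fintype S] (F : S → Matrix n n ℂ) : Prop :=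
  (∀ s, (F s).PosSemidef) ∧ ∑ s, F s = 1

/-- A `(D, T)`-product POVM: a POVM on `(ℂ^D)^{⊗ T}` each of whose elements is a tensor product
of `T` operators on `ℂ^D`. -/
def IsProductPOVM {S : Type*} [Fintype S] (D T : ℕ)
    (F : S → Matrix (Fin T → Fin D) (Fin T → Fin D) ℂ) : Prop :=
  IsPOVM F ∧ ∀ s, ∃ G : Fin T → Matrix (Fin D) (Fin D) ℂ, F s = tensor G

/-- `d_M(ρ₁, ρ₂)`: the total variation distance between the outcome distributions of the
measurement `F` on `ρ₁` and on `ρ₂`. -/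
def povmDist {n S : Type*} [Fintype n] [Fintype S] (F : S → Matrix n n ℂ)
    (ρ₁ ρ₂ : Matrix n n ℂ) : ℝ :=
  (1 / 2) * ∑ s, ‖(F s * ρ₁).trace - (F s * ρ₂).trace‖

/-- A `1`-replica `T`-round protocol on a `D`-dimensional state for deciding between two
hypotheses. In round `t` one copy is measured by a POVM that may depend on all earlier outcomes
`h`; at the end the first hypothesis is announced with probability `accept s`, which depends on
all outcomes `s` (both deterministic and randomised decisions are covered). The outcome set `S` is
the same in all rounds, which is no restriction since POVM elements may vanish. -/
structure Protocol (D T : ℕ) (S : Type*) [Fintype S] where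
  F : ∀ t : Fin T, (Fin t → S) → S → Matrix (Fin D) (Fin D) ℂ
  isPOVM : ∀ t h, IsPOVM (F t h)
  accept : (Fin T → S) → ℝ
  accept_nonneg : ∀ s, 0 ≤ accept s
  accept_le_one : ∀ s, accept s ≤ 1

namespace Protocol

variable {D T : ℕ} {S : Type*} [Fintype S] (P : Protocol D T S)

/-- The operator of round `t` along the outcome sequence `s`, i.e. `F_{s_1, …, s_t}`. -/
def factor (s : Fin T → S) (t : Fin T) : Matrix (Fin D) (Fin D) ℂ :=
  P.F t (fun i => s (Fin.castLE t.isLt.le i)) (s t)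

/-- The `1`-replica `T`-round POVM `{F_{s_1} ⊗ F_{s_1,s_2} ⊗ ⋯ ⊗ F_{s_1,…,s_T}}`. -/
def povm (s : Fin T → S) : Matrix (Fin T → Fin D) (Fin T → Fin D) ℂ :=
  tensor (P.factor s)

/-- The probability of observing the outcomes `s` when every copy is in the state `σ`. -/
def outcomeProb (σ : Matrix (Fin D) (Fin D) ℂ) (s : Fin T → S) : ℝ :=
  ∏ t, ((P.factor s t * σ).trace).re

/-- The probability of announcing the first hypothesis when the unknown state is `σ`. -/
def acceptProb (σ : Matrix (Fin D) (Fin D) ℂ) : ℝ :=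
  ∑ s : Fin T → S, P.accept s * P.outcomeProb σ s

/-- The probability of a correct answer when a fair coin decides whether the unknown state is
drawn from the ensemble `E` (first hypothesis) or equals its average (second hypothesis). -/
def successProb {m : ℕ} (E : Ensemble m D) : ℝ :=
  (1 / 2) * (∫ ψ, P.acceptProb (E.state ψ) ∂E.law) + (1 / 2) * (1 - P.acceptProb E.mean)

end Protocol

end HaarAssembled

end

/-! Fix one term of the mixture for each copy, say `j t` in copy `t`. For a positive semidefinite
product effect, the outcome weight on these terms is a product over `t` of functions of the shared
kets, each a sum of squares |p(ψ)|² with p a polynomial of multidegree `E.a (j t)`. The moment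
𝔼[σ^{⊗T}] integrates this product over the same kets, while (𝔼[σ])^{⊗T} multiplies the separate
integrals. The question is how much the first can fall below the second.

Haar averages of |p|² are Bargmann–Fock norms divided by rising factorials of the dimensions
(`integral_normSq_eval`), and Fock norms satisfy Bombieri's inequality ‖p‖²‖q‖² ≤ ‖pq‖² for
homogeneous factors (`fockSq_mul_ge`). Hence the shared average is at least `momentRatio` times the
product of averages (`momentRatio_mul_prod_integral_le`). This ratio of rising factorials is 1 up to
a sum, over pairs of distinct copies, of collisions of the same Haar ket (`one_sub_momentRatio_le`).

A lower bound alone is enough: both outcome distributions have total mass one, so their distance is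
the sum of the positive parts of Q - P. Averaging the collision bound over independent indices `j t`
gives T(T-1) ∑ a_r²/d_r (`povmDist_moment_le`). The summand with a'_r is pure slack. The bounds for
protocols follow from the usual estimate of a guessing probability by total variation. -/

namespace HaarAssembled

open Finset MvPolynomial

/-! ### Bombieri's inequality for the Fock norm -/

section Bombieri

/-- The number `a! b! / (a - k)!` if `a - k = b - n` is a natural number, and zero otherwise. -/
noncomputable def transfer (c : ℕ × ℕ) (a b : ℕ) : ℝ :=
  if c.1 ≤ a ∧ a + c.2 = b + c.1 then (a.factorial * b.factorial / (a - c.1).factorial : ℝ) else 0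

theorem transfer_self (a b : ℕ) : transfer (a, b) a b = (a.factorial * b.factorial : ℝ) := by
  simp [transfer, add_comm]

/-- For given k the index n is forced to be b' + k - a, and the surviving term equals a! b! C(a', k)
C(b', a - k). Vandermonde's identity sums these to a! b! C(a + b, a). This is the one-variable form
of the expansion of ‖pq‖² into squares. -/
theorem sum_transfer_mul_transfer {N a b a' b' : ℕ} (ha : a ≤ N) (hb' : b' ≤ N) :
    ∑ c ∈ range (N + 1) ×ˢ range (N + 1),
      transfer c a b' * transfer c a' b / (c.1.factorial * c.2.factorial : ℝ) =
      if a + b = a' + b' then ((a + b).factorial : ℝ) else 0 := by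
  split_ifs with h
  · have hv : ((a + b).factorial : ℝ) = ∑ k ∈ range (a + 1),
        (a.factorial * b.factorial * (a'.choose k * b'.choose (a - k)) : ℝ) := by
      rw [← Finset.mul_sum]
      have h1 := Nat.add_choose_eq a' b' a
      rw [Nat.sum_antidiagonal_eq_sum_range_succ (fun i j => a'.choose i * b'.choose j)] at h1
      have h2 : (∑ k ∈ range (a + 1), (a'.choose k * b'.choose (a - k) : ℝ)) =
          ((a + b).choose a : ℝ) := by
        rw [h, h1]; push_cast; rfl
      rw [h2, Nat.cast_add_choose]
      field_simp
    rw [hv, sum_product]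
    rw [← Finset.sum_subset (Finset.range_subset_range.2 (Nat.succ_le_succ ha))]
    · refine sum_congr rfl fun k hk => ?_
      have hka : k ≤ a := Nat.lt_succ_iff.1 (mem_range.1 hk)
      by_cases h1 : k ≤ a' ∧ a - k ≤ b'
      · rw [sum_eq_single (b' + k - a)]
        · have e1 : a + (b' + k - a) = b' + k := by omega
          have e2 : a' + (b' + k - a) = b + k := by omega
          simp only [transfer, hka, e1, e2, h1.1, and_self, if_true]
          rw [Nat.cast_choose ℝ h1.1, Nat.cast_choose ℝ h1.2]
          have e3 : b' - (a - k) = b' + k - a := by omega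
          rw [e3]
          field_simp
        · intro n _ hn
          have : ¬ (a + n = b' + k) := by omega
          simp [transfer, this]
        · intro hn
          exfalso; apply hn; rw [mem_range]; omega
      · rw [sum_eq_zero]
        · rcases not_and_or.1 h1 with h1 | h1
          · rw [Nat.choose_eq_zero_of_lt (not_le.1 h1)]; simp
          · rw [Nat.choose_eq_zero_of_lt (not_le.1 h1)]; simp
        · intro n _
          have : ¬ (a + n = b' + k ∧ k ≤ a') := by omega
          by_cases h2 : a + n = b' + k
          · have : ¬ k ≤ a' := fun h => this ⟨h2, h⟩
            simp [transfer, this]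
          · simp [transfer, h2]
    · intro k _ hk
      have : ¬ k ≤ a := by simpa [Nat.lt_succ_iff] using hk
      simp [transfer, this]
  · refine sum_eq_zero fun c _ => ?_
    by_cases h1 : a + c.2 = b' + c.1
    · have : ¬ (a' + c.2 = b + c.1) := by omega
      simp [transfer, this]
    · simp [transfer, h1]

variable {ι : Type*} [Fintype ι]

/-- The factorial of a multi-index. -/
noncomputable def multiFactorial (α : ι →₀ ℕ) : ℝ := ∏ i, ((α i).factorial : ℝ)

theorem multiFactorial_pos (α : ι →₀ ℕ) : 0 < multiFactorial α :=
  prod_pos fun _ _ => by positivity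

/-- The squared norm of a polynomial in the Bargmann–Fock space. -/
noncomputable def fockSq (p : MvPolynomial ι ℂ) : ℝ := ∑ α ∈ p.support, multiFactorial α * ‖p.coeff α‖ ^ 2

theorem fockSq_nonneg (p : MvPolynomial ι ℂ) : 0 ≤ fockSq p :=
  sum_nonneg fun _ _ => mul_nonneg (multiFactorial_pos _).le (sq_nonneg _)

open Classical in
theorem fockSq_sum_monomial {I : Type*} (s : Finset I) (m : I → ι →₀ ℕ) (c : I → ℂ) :
    (fockSq (∑ i ∈ s, monomial (m i) (c i)) : ℂ) =
      ∑ i ∈ s, ∑ j ∈ s, c i * star (c j) *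
        (if m i = m j then (multiFactorial (m i) : ℂ) else 0) := by
  set p := ∑ i ∈ s, monomial (m i) (c i) with hp
  have hcoeff : ∀ γ, p.coeff γ = ∑ i ∈ s, if m i = γ then c i else 0 := by
    intro γ; simp [hp, coeff_sum, coeff_monomial]
  have hsup : p.support ⊆ s.image m := by
    intro γ hγ
    rw [mem_support_iff, hcoeff] at hγ
    obtain ⟨i, hi, hne⟩ := exists_ne_zero_of_sum_ne_zero hγ
    exact mem_image.2 ⟨i, hi, by by_contra h; simp [h] at hne⟩
  have h1 : fockSq p = ∑ γ ∈ s.image m, multiFactorial γ * ‖p.coeff γ‖ ^ 2 := by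
    refine sum_subset hsup fun γ _ h => ?_
    rw [notMem_support_iff.1 h]; simp
  have h2 : ∀ γ, ((multiFactorial γ * ‖p.coeff γ‖ ^ 2 : ℝ) : ℂ) =
      ∑ i ∈ s, ∑ j ∈ s, if m i = γ then c i * star (c j) *
        (if m i = m j then (multiFactorial (m i) : ℂ) else 0) else 0 := by
    intro γ
    push_cast
    rw [← Complex.mul_conj', hcoeff, map_sum, sum_mul_sum, mul_sum]
    refine sum_congr rfl fun i _ => ?_
    rw [mul_sum]
    refine sum_congr rfl fun j _ => ?_
    by_cases hi : m i = γ
    · by_cases hj : m j = γ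
      · simp [hi, hj]; ring
      · simp [hi, hj, Ne.symm hj]
    · simp [hi]
  rw [h1, Complex.ofReal_sum, sum_congr rfl fun γ _ => h2 γ, sum_comm]
  refine sum_congr rfl fun i hi => ?_
  rw [sum_comm]
  refine sum_congr rfl fun j _ => ?_
  rw [sum_ite_eq, if_pos (mem_image_of_mem _ hi)]

/-- ‖pq‖² equals the squared norm of ∑_j (1/j!) ∂^j p(z) · conj(∂^j q(w)), hence is a sum of squares
indexed by pairs of exponents. Keep only the pairs (α, β) in the supports of p and q. Since the
support of p is an antichain, only j = 0 contributes there, and these squares add up to ‖p‖²‖q‖². -/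
theorem fockSq_mul_ge {p q : MvPolynomial ι ℂ}
    (hp : ∀ α ∈ p.support, ∀ β ∈ p.support, α ≤ β → α = β) :
    fockSq p * fockSq q ≤ fockSq (p * q) := by
  classical
  obtain ⟨N, hN⟩ : ∃ N, ∀ γ ∈ p.support ∪ q.support, ∀ i, γ i ≤ N :=
    ⟨∑ γ ∈ p.support ∪ q.support, ∑ i, γ i, fun γ hγ i =>
      (single_le_sum (f := fun i => γ i) (fun _ _ => Nat.zero_le _) (mem_univ i)).trans
        (single_le_sum (f := fun γ : ι →₀ ℕ => ∑ i, γ i) (fun _ _ => Nat.zero_le _) hγ)⟩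
  have hNp : ∀ α ∈ p.support, ∀ i, α i ≤ N := fun α h => hN α (mem_union_left _ h)
  have hNq : ∀ α ∈ q.support, ∀ i, α i ≤ N := fun α h => hN α (mem_union_right _ h)
  let K : Finset (ι → ℕ × ℕ) := Fintype.piFinset fun _ => range (N + 1) ×ˢ range (N + 1)
  let V : (ι → ℕ × ℕ) → (ι →₀ ℕ) → (ι →₀ ℕ) → ℝ := fun c α β => ∏ i, transfer (c i) (α i) (β i)
  let w : (ι → ℕ × ℕ) → ℝ := fun c => ∏ i, ((c i).1.factorial * (c i).2.factorial : ℝ)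
  have hw : ∀ c, 0 < w c := fun c => prod_pos fun _ _ => by positivity
  have hV : ∀ α ∈ p.support, ∀ β, ∀ α', ∀ β' ∈ q.support,
      (if α + β = α' + β' then multiFactorial (α + β) else 0) =
        ∑ c ∈ K, V c α β' * V c α' β / w c := by
    intro α hα β α' β' hβ'
    simp only [V, w, ← prod_mul_distrib, ← prod_div_distrib]
    rw [← prod_univ_sum (fun _ => range (N + 1) ×ˢ range (N + 1))
      (fun i x => transfer x (α i) (β' i) * transfer x (α' i) (β i) /
        (x.1.factorial * x.2.factorial : ℝ))]
    simp only [sum_transfer_mul_transfer (hNp α hα _) (hNq β' hβ' _)]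
    split_ifs with h
    · refine prod_congr rfl fun i _ => ?_
      have : α i + β i = α' i + β' i := by simpa using DFunLike.congr_fun h i
      simp [this]
    · have : ∃ i, ¬ (α i + β i = α' i + β' i) := by
        by_contra h'
        push Not at h'
        exact h (Finsupp.ext h')
      obtain ⟨i, hi⟩ := this
      exact (prod_eq_zero (mem_univ i) (by simp [hi])).symm
  -- Up to the weight `w c`, this is a coefficient of the contracted product of p with the conjugate
  -- of q.
  let R : (ι → ℕ × ℕ) → ℂ := fun c =>
    ∑ α ∈ p.support, ∑ β ∈ q.support, (V c α β : ℂ) * (p.coeff α * star (q.coeff β))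
  have hpq : p * q = ∑ x ∈ p.support ×ˢ q.support,
      monomial (x.1 + x.2) (p.coeff x.1 * q.coeff x.2) := by
    conv_lhs => rw [p.as_sum, q.as_sum, sum_mul_sum]
    rw [sum_product]
    simp [monomial_mul]
  -- In the double sum for ‖pq‖² the two exponents of q are exchanged: p_α is paired with conj q_β',
  -- and conj p_α' with q_β. This turns the sum into R times its conjugate.
  have key : fockSq (p * q) = ∑ c ∈ K, ‖R c‖ ^ 2 / w c := by
    apply Complex.ofReal_injective
    rw [hpq, fockSq_sum_monomial]
    have e1 : ∀ x ∈ p.support ×ˢ q.support, ∀ y ∈ p.support ×ˢ q.support,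
        p.coeff x.1 * q.coeff x.2 * star (p.coeff y.1 * q.coeff y.2) *
          (if x.1 + x.2 = y.1 + y.2 then (multiFactorial (x.1 + x.2) : ℂ) else 0) =
        ∑ c ∈ K, (V c x.1 y.2 * (p.coeff x.1 * star (q.coeff y.2))) *
          (V c y.1 x.2 * star (p.coeff y.1 * star (q.coeff x.2))) / (w c : ℂ) := by
      intro x hx y hy
      have := hV x.1 (mem_product.1 hx).1 x.2 y.1 y.2 (mem_product.1 hy).2
      have h2 : (if x.1 + x.2 = y.1 + y.2 then (multiFactorial (x.1 + x.2) : ℂ) else 0) =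
          ((∑ c ∈ K, V c x.1 y.2 * V c y.1 x.2 / w c : ℝ) : ℂ) := by
        rw [← this]; split_ifs <;> simp
      rw [h2]
      push_cast
      rw [mul_sum]
      refine sum_congr rfl fun c _ => ?_
      simp only [star_mul', star_star]
      ring
    rw [sum_congr rfl fun x hx => sum_congr rfl fun y hy => e1 x hx y hy]
    push_cast
    rw [sum_congr rfl fun x _ => sum_comm, sum_comm]
    refine sum_congr rfl fun c _ => ?_
    rw [← Complex.mul_conj']
    have hR : (starRingEnd ℂ) (R c) = ∑ α ∈ p.support, ∑ β ∈ q.support,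
        (V c α β : ℂ) * star (p.coeff α * star (q.coeff β)) := by
      simp [R, map_sum]
    rw [hR]
    simp only [R, ← sum_div]
    congr 1
    rw [sum_mul_sum, sum_product]
    refine sum_congr rfl fun α _ => ?_
    simp only [sum_product, sum_mul_sum]
    rw [sum_comm]
    refine sum_congr rfl fun α' _ => ?_
    rw [sum_comm]
  have hinj : Function.Injective
      (fun x : (ι →₀ ℕ) × (ι →₀ ℕ) => fun i => (x.1 i, x.2 i)) := by
    intro x y h
    refine Prod.ext (Finsupp.ext fun i => ?_) (Finsupp.ext fun i => ?_)
    · exact congrArg Prod.fst (congrFun h i)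
    · exact congrArg Prod.snd (congrFun h i)
  have hRxy : ∀ x ∈ p.support ×ˢ q.support,
      R (fun i => (x.1 i, x.2 i)) =
        ((multiFactorial x.1 * multiFactorial x.2 : ℝ) : ℂ) *
          (p.coeff x.1 * star (q.coeff x.2)) := by
    intro x hx
    -- A nonzero `V` forces `x.1 ≤ α`; the antichain hypothesis makes this an equality, which then
    -- fixes β.
    have hz : ∀ α ∈ p.support, ∀ β, V (fun i => (x.1 i, x.2 i)) α β ≠ 0 → α = x.1 ∧ β = x.2 := by
      intro α hα β h
      have h1 : ∀ i, x.1 i ≤ α i ∧ α i + x.2 i = β i + x.1 i := by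
        intro i
        by_contra h'
        exact h (prod_eq_zero (mem_univ i) (by simp only [transfer]; rw [if_neg h']))
      have h2 : x.1 = α := hp _ (mem_product.1 hx).1 _ hα fun i => (h1 i).1
      refine ⟨h2.symm, Finsupp.ext fun i => ?_⟩
      have := (h1 i).2
      rw [h2] at this
      omega
    simp only [R]
    rw [sum_eq_single x.1, sum_eq_single x.2]
    · simp [V, transfer_self, multiFactorial, prod_mul_distrib]
    · intro β _ hβ
      by_cases h : V (fun i => (x.1 i, x.2 i)) x.1 β = 0
      · simp [h]
      · exact absurd (hz _ (mem_product.1 hx).1 _ h).2 hβ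
    · intro h; exact absurd (mem_product.1 hx).2 h
    · intro α hα hne
      refine sum_eq_zero fun β _ => ?_
      by_cases h : V (fun i => (x.1 i, x.2 i)) α β = 0
      · simp [h]
      · exact absurd (hz _ hα _ h).1 hne
    · intro h; exact absurd (mem_product.1 hx).1 h
  calc fockSq p * fockSq q
      = ∑ x ∈ p.support ×ˢ q.support, ‖R (fun i => (x.1 i, x.2 i))‖ ^ 2 /
          w (fun i => (x.1 i, x.2 i)) := by
        rw [fockSq, fockSq, sum_mul_sum, sum_product]
        refine sum_congr rfl fun α hα => sum_congr rfl fun β hβ => ?_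
        rw [hRxy (α, β) (mem_product.2 ⟨hα, hβ⟩)]
        have : w (fun i => (α i, β i)) = multiFactorial α * multiFactorial β := by
          simp [w, multiFactorial, prod_mul_distrib]
        have h1 := multiFactorial_pos α
        have h2 := multiFactorial_pos β
        simp only [this, norm_mul, norm_star, Complex.norm_real, Real.norm_eq_abs,
          abs_of_pos h1, abs_of_pos h2]
        field_simp
    _ = ∑ c ∈ (p.support ×ˢ q.support).image (fun x i => (x.1 i, x.2 i)), ‖R c‖ ^ 2 / w c := by
        rw [sum_image fun x _ y _ h => hinj h]
    _ ≤ ∑ c ∈ K, ‖R c‖ ^ 2 / w c := by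
        refine sum_le_sum_of_subset_of_nonneg ?_ fun c _ _ =>
          div_nonneg (sq_nonneg _) (hw c).le
        intro c hc
        obtain ⟨x, hx, rfl⟩ := mem_image.1 hc
        refine Fintype.mem_piFinset.2 fun i => mem_product.2 ⟨?_, ?_⟩
        · exact mem_range.2 (Nat.lt_succ_of_le (hNp _ (mem_product.1 hx).1 i))
        · exact mem_range.2 (Nat.lt_succ_of_le (hNq _ (mem_product.1 hx).2 i))
    _ = fockSq (p * q) := key.symm

end Bombieri

/-! ### Moments of a Haar-random unit vector -/

section SphereMoments

/-- A Gaussian moment of the complex plane with respect to the weight `exp (-|z|²)`. -/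
theorem integral_pow_mul_conj_pow_mul_exp (a b : ℕ) :
    ∫ z : ℂ, z ^ a * star z ^ b * (Real.exp (-‖z‖ ^ 2) : ℂ) =
      if a = b then (Real.pi * a.factorial : ℂ) else 0 := by
  split_ifs with h
  · subst h
    have h1 := Complex.integral_rpow_mul_exp_neg_rpow (p := 2) (q := 2 * a) (by norm_num)
      (by have : (0 : ℝ) ≤ a := Nat.cast_nonneg a
          linarith)
    have h2 : ∀ z : ℂ, z ^ a * star z ^ a * (Real.exp (-‖z‖ ^ 2) : ℂ) =
        ((‖z‖ ^ (2 * a : ℝ) * Real.exp (-‖z‖ ^ (2 : ℝ)) : ℝ) : ℂ) := by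
      intro z
      rw [← mul_pow, Complex.star_def, Complex.mul_conj']
      have : ‖z‖ ^ (2 * a : ℝ) = (‖z‖ ^ 2) ^ a := by
        rw [← pow_mul]; exact_mod_cast Real.rpow_natCast ‖z‖ (2 * a)
      rw [this]
      push_cast
      norm_num
    rw [integral_congr_ae (Filter.Eventually.of_forall h2), integral_complex_ofReal, h1]
    have : ((2 * a + 2 : ℝ) / 2) = (a : ℝ) + 1 := by ring
    rw [this, Real.Gamma_nat_eq_factorial]
    push_cast; ring
  · set F : ℂ → ℂ := fun z => z ^ a * star z ^ b * (Real.exp (-‖z‖ ^ 2) : ℂ) with hF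
    -- The rotation by e^{i} works for all a ≠ b at once: otherwise a - b would be a multiple of 2π,
    -- against the irrationality of π. Rotation invariance then forces the integral to vanish.
    obtain ⟨u, hu⟩ : ∃ u : Circle, (u : ℂ) ^ a * star (u : ℂ) ^ b ≠ 1 := by
      refine ⟨Circle.exp 1, fun h1 => h ?_⟩
      rw [Complex.star_def, ← Circle.coe_inv_eq_conj, Circle.coe_inv, inv_pow,
        mul_inv_eq_one₀ (pow_ne_zero _ (Circle.coe_ne_zero _)), Circle.coe_exp, ← Complex.exp_nat_mul,
        ← Complex.exp_nat_mul, Complex.exp_eq_exp_iff_exists_int] at h1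
      obtain ⟨n, hn⟩ := h1
      have h2 : ((a : ℝ) - b) = n * (2 * Real.pi) := by
        have := congrArg Complex.im hn
        simp at this
        linarith
      by_cases hn0 : n = 0
      · subst hn0
        have : (a : ℝ) = b := by simpa [sub_eq_zero] using h2
        exact_mod_cast this
      · exfalso
        have h3 : Real.pi = ((a - b : ℤ) / (2 * n : ℤ) : ℚ) := by
          have : (n : ℝ) ≠ 0 := by exact_mod_cast hn0
          push_cast
          field_simp
          linarith
        exact irrational_pi ⟨_, h3.symm⟩
    have h1 : ∫ z, F z = ((u : ℂ) ^ a * star (u : ℂ) ^ b) * ∫ z, F z := by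
      conv_lhs => rw [← (rotation u).measurePreserving.integral_comp
        (rotation u).toHomeomorph.measurableEmbedding]
      rw [← integral_const_mul]
      refine integral_congr_ae (Filter.Eventually.of_forall fun z => ?_)
      simp only [hF, rotation_apply, star_mul', mul_pow, norm_mul, Circle.norm_coe]
      ring_nf
    have h2 : (((u : ℂ) ^ a * star (u : ℂ) ^ b) - 1) * ∫ z, F z = 0 := by
      rw [sub_mul, one_mul, ← h1, sub_self]
    exact (mul_eq_zero.1 h2).resolve_left (sub_ne_zero.2 hu)

/-- Polar coordinates for a function which is homogeneous of degree `n`. -/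
theorem integral_homogeneous_mul_exp {V : Type*} [NormedAddCommGroup V] [NormedSpace ℝ V]
    [FiniteDimensional ℝ V] [MeasurableSpace V] [BorelSpace V] [Nontrivial V]
    (μ : Measure V) [μ.IsAddHaarMeasure] (G : V → ℂ) (n : ℕ)
    (hG : ∀ (r : ℝ) (x : V), 0 < r → G (r • x) = (r : ℂ) ^ n * G x) :
    ∫ x, G x * (Real.exp (-‖x‖ ^ 2) : ℂ) ∂μ =
      (∫ x, G (x : V) ∂μ.toSphere) *
        ((1 / 2 * Real.Gamma ((n + Module.finrank ℝ V : ℝ) / 2) : ℝ) : ℂ) := by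
  have hdim : 0 < Module.finrank ℝ V := Module.finrank_pos
  calc
    _ = ∫ x : ({(0)}ᶜ : Set V), G x * (Real.exp (-‖x.1‖ ^ 2) : ℂ) ∂(μ.comap (↑)) := by
      rw [integral_subtype_comap (measurableSet_singleton _).compl
        fun x ↦ G x * (Real.exp (-‖x‖ ^ 2) : ℂ), restrict_compl_singleton]
    _ = ∫ x, G (x.1 : V) * ((x.2.1 : ℂ) ^ n * (Real.exp (-x.2.1 ^ 2) : ℂ))
          ∂μ.toSphere.prod (.volumeIoiPow (Module.finrank ℝ V - 1)) := by
      rw [← μ.measurePreserving_homeomorphUnitSphereProd.integral_comp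
        (Homeomorph.measurableEmbedding _)]
      refine integral_congr_ae (Filter.Eventually.of_forall fun x => ?_)
      have hx : (x : V) ≠ 0 := x.2
      have h1 : (x : V) = ‖(x : V)‖ • (‖(x : V)‖⁻¹ • (x : V)) := by
        rw [smul_smul, mul_inv_cancel₀ (norm_ne_zero_iff.2 hx), one_smul]
      have h2 := hG ‖(x : V)‖ (‖(x : V)‖⁻¹ • (x : V)) (norm_pos_iff.2 hx)
      rw [← h1] at h2
      simp [h2]
      ring
    _ = (∫ x, G (x : V) ∂μ.toSphere) * ∫ r : Set.Ioi (0 : ℝ),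
          ((r.1 : ℂ) ^ n * (Real.exp (-r.1 ^ 2) : ℂ))
            ∂(.volumeIoiPow (Module.finrank ℝ V - 1)) := integral_prod_mul (L := ℂ)
          (fun x : Metric.sphere (0 : V) 1 => G x)
          (fun r : Set.Ioi (0 : ℝ) => ((r.1 : ℂ) ^ n * (Real.exp (-r.1 ^ 2) : ℂ)))
    _ = _ := by
      congr 1
      -- The exponent combines r^n from homogeneity with the Jacobian r^(dim - 1).
      have h1 := integral_rpow_mul_exp_neg_rpow (p := 2) (q := (n + Module.finrank ℝ V : ℝ) - 1)
        (by norm_num) (by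
          have : (0 : ℝ) < Module.finrank ℝ V := by exact_mod_cast hdim
          have : (0 : ℝ) ≤ n := Nat.cast_nonneg n
          linarith)
      rw [sub_add_cancel] at h1
      rw [← h1, ← integral_complex_ofReal]
      simp only [Measure.volumeIoiPow, ENNReal.ofReal]
      rw [integral_withDensity_eq_integral_smul,
        integral_subtype_comap measurableSet_Ioi
          fun a ↦ Real.toNNReal (a ^ (Module.finrank ℝ V - 1)) •
            ((a : ℂ) ^ n * (Real.exp (-a ^ 2) : ℂ)),
        setIntegral_congr_fun measurableSet_Ioi fun x hx ↦ ?_]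
      · have hx' : (0 : ℝ) < x := hx
        rw [NNReal.smul_def, Real.coe_toNNReal _ (pow_nonneg hx'.le _)]
        have : x ^ ((n + Module.finrank ℝ V : ℝ) - 1) =
            x ^ (Module.finrank ℝ V - 1) * x ^ n := by
          rw [← pow_add, ← Real.rpow_natCast]
          congr 1
          rw [Nat.cast_add, Nat.cast_sub hdim]
          push_cast; ring
        rw [this]
        simp [mul_assoc]
      · exact (measurable_subtype_coe.pow_const _).real_toNNReal

theorem measure_toSphere_univ_ne_zero {d : ℕ} (hd : 0 < d) :
    (volume : Measure (EuclideanSpace ℂ (Fin d))).toSphere Set.univ ≠ 0 := by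
  have : Nonempty (Fin d) := ⟨⟨0, hd⟩⟩
  rw [Ne, Measure.measure_univ_eq_zero]
  exact Measure.toSphere_ne_zero _

theorem isProbabilityMeasure_haarKet {d : ℕ} (hd : 0 < d) :
    IsProbabilityMeasure (haarKet d) := by
  refine ⟨?_⟩
  rw [haarKet, Measure.smul_apply, smul_eq_mul]
  exact ENNReal.inv_mul_cancel (measure_toSphere_univ_ne_zero hd) (measure_ne_top _ _)

/-- The moments of the uniform distribution on the unit sphere of `ℂ^d`, in equal degrees. -/
theorem integral_haarKet_moment {d : ℕ} (hd : 0 < d) (α β : Fin d → ℕ) {k : ℕ}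
    (hα : ∑ i, α i = k) (hβ : ∑ i, β i = k) :
    ∫ ψ : Ket d, ∏ i, ((ψ : EuclideanSpace ℂ (Fin d)) i ^ α i *
        star ((ψ : EuclideanSpace ℂ (Fin d)) i) ^ β i) ∂haarKet d =
      if α = β then ((∏ i, ((α i).factorial : ℂ)) / (d.ascFactorial k : ℂ)) else 0 := by
  have : Nonempty (Fin d) := ⟨⟨0, hd⟩⟩
  set V := EuclideanSpace ℂ (Fin d) with hV
  let G : (Fin d → ℕ) → (Fin d → ℕ) → V → ℂ := fun α β x => ∏ i, (x i ^ α i * star (x i) ^ β i)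
  have hfin : (Module.finrank ℝ V : ℝ) = 2 * d := by
    have : Module.finrank ℝ V = 2 * d := by
      rw [← Module.finrank_mul_finrank ℝ ℂ V, Complex.finrank_real_complex,
        finrank_euclideanSpace_fin]
    rw [this]; push_cast; ring
  -- The value of the factor between the two Haar measures is irrelevant: it cancels when the sphere
  -- is normalised.
  obtain ⟨c, hc0, hct, hc⟩ : ∃ c : ENNReal, c ≠ 0 ∧ c ≠ ⊤ ∧ (volume : Measure V) =
      c • (volume : Measure (Fin d → ℂ)).map
        (PiLp.continuousLinearEquiv 2 ℝ (fun _ : Fin d => ℂ)).symm :=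
    ⟨_, ENNReal.coe_ne_zero.2 (Measure.addHaarScalarFactor_pos_of_isAddHaarMeasure _ _).ne',
      ENNReal.coe_ne_top, Measure.isAddLeftInvariant_eq_smul _ _⟩
  have hgauss : ∀ α β : Fin d → ℕ,
      ∫ x : V, G α β x * (Real.exp (-‖x‖ ^ 2) : ℂ) =
        (c.toReal : ℂ) * ∏ i, if α i = β i then (Real.pi * (α i).factorial : ℂ) else 0 := by
    intro α β
    rw [hc, integral_smul_measure]
    have hemb : MeasurableEmbedding (PiLp.continuousLinearEquiv 2 ℝ (fun _ : Fin d => ℂ)).symm :=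
      (PiLp.continuousLinearEquiv 2 ℝ
        (fun _ : Fin d => ℂ)).symm.toHomeomorph.measurableEmbedding
    rw [hemb.integral_map]
    rw [Complex.real_smul]
    congr 1
    simp only [← integral_pow_mul_conj_pow_mul_exp]
    rw [← integral_fintype_prod_volume_eq_prod]
    refine integral_congr_ae (Filter.Eventually.of_forall fun x => ?_)
    have hnorm : ‖(PiLp.continuousLinearEquiv 2 ℝ (fun _ : Fin d => ℂ)).symm x‖ ^ 2 =
        ∑ i, ‖x i‖ ^ 2 := EuclideanSpace.norm_sq_eq _
    simp only [G, hnorm]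
    rw [← Finset.sum_neg_distrib, Real.exp_sum, Complex.ofReal_prod, ← Finset.prod_mul_distrib]
    rfl
  have hhom : ∀ (α β : Fin d → ℕ) (r : ℝ) (x : V), 0 < r →
      G α β (r • x) = (r : ℂ) ^ (∑ i, (α i + β i)) * G α β x := by
    intro α β r x _
    simp only [G]
    rw [← Finset.prod_pow_eq_pow_sum, ← Finset.prod_mul_distrib]
    refine Finset.prod_congr rfl fun i _ => ?_
    have : (r • x) i = (r : ℂ) * x i := rfl
    rw [this, star_mul', Complex.star_def, Complex.conj_ofReal, mul_pow, mul_pow, pow_add]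
    ring
  have hpolar : ∀ α β : Fin d → ℕ, (c.toReal : ℂ) *
      (∏ i, if α i = β i then (Real.pi * (α i).factorial : ℂ) else 0) =
      (∫ x : Ket d, G α β (x : V) ∂(volume : Measure V).toSphere) *
        ((1 / 2 * Real.Gamma (((∑ i, (α i + β i) : ℕ) + 2 * d : ℝ) / 2) : ℝ) : ℂ) := by
    intro α β
    rw [← hgauss, integral_homogeneous_mul_exp volume (G α β) _ (hhom α β), hfin]
  obtain ⟨e, rfl⟩ : ∃ e, d = e + 1 := ⟨d - 1, by omega⟩
  -- Degree zero gives the total mass of the sphere. Dividing by it removes `c` and the powers of π,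
  -- and leaves Γ(d)/Γ(d + k), the inverse rising factorial.
  have h0 := hpolar 0 0
  have h1 := hpolar α β
  have hs : ∑ i, (α i + β i) = 2 * k := by rw [Finset.sum_add_distrib, hα, hβ]; ring
  have hg0 : Real.Gamma ((((0 : ℕ)) + 2 * (e + 1 : ℕ) : ℝ) / 2) = e.factorial := by
    rw [← Real.Gamma_nat_eq_factorial]; congr 1; push_cast; ring
  have hg1 : Real.Gamma ((((2 * k : ℕ)) + 2 * (e + 1 : ℕ) : ℝ) / 2) = (e + k).factorial := by
    rw [← Real.Gamma_nat_eq_factorial]; congr 1; push_cast; ring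
  rw [hs, hg1] at h1
  simp only [Pi.zero_apply, add_zero, Finset.sum_const_zero, hg0, if_true, Nat.factorial_zero,
    Nat.cast_one, mul_one, Finset.prod_const, Finset.card_univ, Fintype.card_fin, G, pow_zero, one_pow] at h0
  set m : Measure (Ket (e + 1)) := (volume : Measure V).toSphere with hm
  have hint : ∫ _x : Ket (e + 1), (1 : ℂ) ∂m = (m.real Set.univ : ℂ) := by
    simp [Measure.real]
  rw [hint] at h0
  have hreal : m.real Set.univ ≠ 0 :=
    ENNReal.toReal_ne_zero.2 ⟨measure_toSphere_univ_ne_zero hd, measure_ne_top _ _⟩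
  have hcr : c.toReal ≠ 0 := ENNReal.toReal_ne_zero.2 ⟨hc0, hct⟩
  have hasc : ((e + k).factorial : ℂ) = e.factorial * ((e + 1).ascFactorial k : ℂ) := by
    rw [← Nat.cast_mul, Nat.factorial_mul_ascFactorial]
  have hp : ∏ i, (if α i = β i then (Real.pi * (α i).factorial : ℂ) else 0) =
      if α = β then (Real.pi : ℂ) ^ (e + 1) * ∏ i, ((α i).factorial : ℂ) else 0 := by
    split_ifs with h
    · subst h; simp [Finset.prod_mul_distrib]
    · obtain ⟨i, hi⟩ := Function.ne_iff.1 h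
      exact Finset.prod_eq_zero (Finset.mem_univ i) (by simp [hi])
  have hI : ∫ ψ : Ket (e + 1), G α β ψ ∂haarKet (e + 1) =
      ((m.real Set.univ : ℂ))⁻¹ * ∫ ψ : Ket (e + 1), G α β ψ ∂m := by
    rw [haarKet, integral_smul_measure, Complex.real_smul, ENNReal.toReal_inv]
    push_cast; rfl
  change ∫ ψ : Ket (e + 1), G α β ψ ∂haarKet (e + 1) = _
  rw [hI]
  rw [hp] at h1
  rw [Complex.ofReal_mul, Complex.ofReal_natCast, hasc] at h1
  rw [Complex.ofReal_mul, Complex.ofReal_natCast] at h0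
  have hfac : (e.factorial : ℂ) ≠ 0 := by exact_mod_cast e.factorial_ne_zero
  have hA : ((e + 1).ascFactorial k : ℂ) ≠ 0 := by
    exact_mod_cast (Nat.ascFactorial_pos e k).ne'
  have hr' : (m.real Set.univ : ℂ) ≠ 0 := by exact_mod_cast hreal
  have hc' : (c.toReal : ℂ) ≠ 0 := by exact_mod_cast hcr
  have hpi : (Real.pi : ℂ) ≠ 0 := by exact_mod_cast Real.pi_ne_zero
  split_ifs at h1 ⊢ with h
  · rw [eq_div_iff hA, inv_mul_eq_div, div_mul_eq_mul_div, div_eq_iff hr']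
    have h2 : ((1 / 2 : ℝ) : ℂ) * e.factorial ≠ 0 := mul_ne_zero (by norm_num) hfac
    apply mul_right_cancel₀ h2
    calc _ = (∫ ψ : Ket (e + 1), G α β ψ ∂m) *
          (((1 / 2 : ℝ) : ℂ) * (e.factorial * (e + 1).ascFactorial k)) := by ring
      _ = _ := by
        rw [← h1]
        calc _ = (c.toReal * (Real.pi : ℂ) ^ (e + 1)) * ∏ i, ((α i).factorial : ℂ) := by ring
          _ = _ := by rw [h0]; ring
  · rw [mul_zero] at h1
    have h2 : ((1 / 2 : ℝ) : ℂ) * (e.factorial * ((e + 1).ascFactorial k : ℂ)) ≠ 0 :=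
      mul_ne_zero (by norm_num) (mul_ne_zero hfac hA)
    rw [(mul_eq_zero.1 h1.symm).resolve_right h2, mul_zero]

end SphereMoments

/-! ### Haar averages of products of sums of squares -/

section SquareSums

open Finset MvPolynomial

variable {m : ℕ} {d : Fin m → ℕ}

/-- The weights recording the degree in each of the blocks of variables. -/
def blockWeight (d : Fin m → ℕ) (x : Σ r, Fin (d r)) : Fin m → ℕ := Pi.single x.1 1

theorem weight_blockWeight (α : (Σ r, Fin (d r)) →₀ ℕ) (r : Fin m) :
    Finsupp.weight (blockWeight d) α r = ∑ i, α ⟨r, i⟩ := by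
  rw [Finsupp.weight_apply, Finsupp.sum_fintype _ _ (by simp), Fintype.sum_sigma,
    Finset.sum_apply, Finset.sum_eq_single r]
  · simp [blockWeight]
  · intro b _ hb
    simp [blockWeight, hb.symm]
  · simp

/-- The coordinates of a family of unit vectors. -/
noncomputable def coords (ψ : ∀ r, Ket (d r)) (x : Σ r, Fin (d r)) : ℂ :=
  (ψ x.1 : EuclideanSpace ℂ (Fin (d x.1))) x.2

theorem continuous_coords (x : Σ r, Fin (d r)) :
    Continuous fun ψ : ∀ r, Ket (d r) => coords ψ x := by
  unfold coords
  fun_prop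

theorem continuous_eval_coords (p : MvPolynomial (Σ r, Fin (d r)) ℂ) :
    Continuous fun ψ : ∀ r, Ket (d r) => eval (coords ψ) p := by
  have := fun x => continuous_coords (d := d) x
  simp only [eval_eq]
  fun_prop

theorem isProbabilityMeasure_pi_haarKet (hd : ∀ r, 0 < d r) :
    IsProbabilityMeasure (Measure.pi fun r => haarKet (d r)) := by
  have := fun r => isProbabilityMeasure_haarKet (hd r)
  infer_instance

theorem integrable_pi_haarKet {V : Type*} [NormedAddCommGroup V] (hd : ∀ r, 0 < d r)
    {f : (∀ r, Ket (d r)) → V} (hf : Continuous f) :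
    Integrable f (Measure.pi fun r => haarKet (d r)) := by
  have := isProbabilityMeasure_pi_haarKet hd
  exact hf.integrable_of_hasCompactSupport (HasCompactSupport.of_compactSpace f)

/-- Monomial moments factor over the independent kets, and distinct monomials of equal multidegree
are orthogonal. The common multidegree makes the normalisation the same for all monomials. -/
theorem integral_normSq_eval (hd : ∀ r, 0 < d r) {p : MvPolynomial (Σ r, Fin (d r)) ℂ}
    {a : Fin m → ℕ} (hp : IsWeightedHomogeneous (blockWeight d) p a) :
    ∫ ψ, ‖eval (coords ψ) p‖ ^ 2 ∂(Measure.pi fun r => haarKet (d r)) =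
      fockSq p / ∏ r, ((d r).ascFactorial (a r) : ℝ) := by
  have := fun r => isProbabilityMeasure_haarKet (hd r)
  set μ := Measure.pi fun r => haarKet (d r)
  have hdeg : ∀ α ∈ p.support, ∀ r, ∑ i, α ⟨r, i⟩ = a r := fun α hα r => by
    rw [← weight_blockWeight, hp (mem_support_iff.1 hα)]
  have hmom : ∀ α ∈ p.support, ∀ β ∈ p.support,
      ∫ ψ, ∏ r, ∏ i, (coords ψ ⟨r, i⟩ ^ α ⟨r, i⟩ * star (coords ψ ⟨r, i⟩) ^ β ⟨r, i⟩) ∂μ =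
        if α = β then (multiFactorial α : ℂ) / ∏ r, ((d r).ascFactorial (a r) : ℂ) else 0 := by
    intro α hα β hβ
    have h1 := integral_fintype_prod_eq_prod (μ := fun r => haarKet (d r))
      (fun r (ψ : Ket (d r)) => ∏ i, ((ψ : EuclideanSpace ℂ (Fin (d r))) i ^ α ⟨r, i⟩ *
        star ((ψ : EuclideanSpace ℂ (Fin (d r))) i) ^ β ⟨r, i⟩))
    refine h1.trans ?_
    rw [prod_congr rfl fun r _ => integral_haarKet_moment (hd r) (fun i => α ⟨r, i⟩)
      (fun i => β ⟨r, i⟩) (hdeg α hα r) (hdeg β hβ r)]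
    split_ifs with h
    · subst h
      simp [multiFactorial, prod_div_distrib, Fintype.prod_sigma]
    · have : ∃ r, ¬ ((fun i => α ⟨r, i⟩) = fun i => β ⟨r, i⟩) := by
        by_contra h'
        push Not at h'
        exact h (Finsupp.ext fun x => congrFun (h' x.1) x.2)
      obtain ⟨r, hr⟩ := this
      exact prod_eq_zero (mem_univ r) (if_neg hr)
  have hexp : ∀ ψ : ∀ r, Ket (d r), ((‖eval (coords ψ) p‖ ^ 2 : ℝ) : ℂ) =
      ∑ α ∈ p.support, ∑ β ∈ p.support, (p.coeff α * star (p.coeff β)) *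
        ∏ r, ∏ i, (coords ψ ⟨r, i⟩ ^ α ⟨r, i⟩ * star (coords ψ ⟨r, i⟩) ^ β ⟨r, i⟩) := by
    intro ψ
    push_cast
    rw [← Complex.mul_conj', eval_eq', map_sum, sum_mul_sum]
    refine sum_congr rfl fun α _ => sum_congr rfl fun β _ => ?_
    simp only [map_mul, map_prod, map_pow, prod_mul_distrib, Fintype.prod_sigma,
      Complex.star_def]
    ring
  apply Complex.ofReal_injective
  rw [← integral_complex_ofReal, integral_congr_ae (Filter.Eventually.of_forall hexp)]
  have hcont : ∀ α β : (Σ r, Fin (d r)) →₀ ℕ, Continuous fun ψ : ∀ r, Ket (d r) =>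
      (p.coeff α * star (p.coeff β)) *
        ∏ r, ∏ i, (coords ψ ⟨r, i⟩ ^ α ⟨r, i⟩ * star (coords ψ ⟨r, i⟩) ^ β ⟨r, i⟩) := by
    intro α β
    have := fun x => continuous_coords (d := d) x
    fun_prop
  rw [integral_finsetSum _ fun α _ => integrable_pi_haarKet hd
    (continuous_finsetSum _ fun β _ => hcont α β)]
  rw [fockSq, Complex.ofReal_div, Complex.ofReal_sum, sum_div]
  refine sum_congr rfl fun α hα => ?_
  rw [integral_finsetSum _ fun β _ => integrable_pi_haarKet hd (hcont α β),
    sum_eq_single α]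
  · rw [integral_const_mul, hmom α hα α hα, if_pos rfl, Complex.star_def, Complex.mul_conj']
    push_cast
    ring
  · intro β hβ hne
    rw [integral_const_mul, hmom α hα β hβ, if_neg hne.symm, mul_zero]
  · intro h; exact absurd hα h

theorem eq_of_le_of_mem_support {p : MvPolynomial (Σ r, Fin (d r)) ℂ} {a : Fin m → ℕ}
    (hp : IsWeightedHomogeneous (blockWeight d) p a) (α : (Σ r, Fin (d r)) →₀ ℕ)
    (hα : α ∈ p.support) (β : (Σ r, Fin (d r)) →₀ ℕ) (hβ : β ∈ p.support) (h : α ≤ β) :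
    α = β := by
  refine Finsupp.ext fun ⟨r, i⟩ => ?_
  have hs : ∑ i, α ⟨r, i⟩ = ∑ i, β ⟨r, i⟩ := by
    rw [← weight_blockWeight, ← weight_blockWeight, hp (mem_support_iff.1 hα),
      hp (mem_support_iff.1 hβ)]
  exact (sum_eq_sum_iff_of_le fun i _ => h ⟨r, i⟩).1 hs i (mem_univ i)

/-- `fockSq_mul_ge` needs the antichain condition for its left factor only, so the induction carries
no information about the partial product. -/
theorem prod_fockSq_le {ι : Type*} (s : Finset ι) (p : ι → MvPolynomial (Σ r, Fin (d r)) ℂ)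
    (a : ι → Fin m → ℕ) (hp : ∀ t, IsWeightedHomogeneous (blockWeight d) (p t) (a t)) :
    ∏ t ∈ s, fockSq (p t) ≤ fockSq (∏ t ∈ s, p t) := by
  classical
  induction s using Finset.induction_on with
  | empty =>
    have : (1 : MvPolynomial (Σ r, Fin (d r)) ℂ).support = {0} := by
      rw [← C_1, ← monomial_zero', support_monomial]; simp
    simp [fockSq, this, multiFactorial]
  | insert t s ht ih =>
    rw [prod_insert ht, prod_insert ht]
    exact (mul_le_mul_of_nonneg_left ih (fockSq_nonneg _)).trans
      (fockSq_mul_ge (eq_of_le_of_mem_support (hp t)))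

/-- A function on families of unit vectors which is a sum of squared absolute values of
polynomials of multidegree `a`. -/
def IsSquareSum (a : Fin m → ℕ) (f : (∀ r, Ket (d r)) → ℝ) : Prop :=
  ∃ (K : Type) (_ : Fintype K) (p : K → MvPolynomial (Σ r, Fin (d r)) ℂ),
    (∀ k, IsWeightedHomogeneous (blockWeight d) (p k) a) ∧
      ∀ ψ, f ψ = ∑ k, ‖eval (coords ψ) (p k)‖ ^ 2

theorem IsSquareSum.nonneg {a : Fin m → ℕ} {f : (∀ r, Ket (d r)) → ℝ} (hf : IsSquareSum a f)
    (ψ : ∀ r, Ket (d r)) : 0 ≤ f ψ := by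
  obtain ⟨K, _, p, -, h⟩ := hf
  rw [h]
  exact sum_nonneg fun _ _ => sq_nonneg _

theorem IsSquareSum.continuous {a : Fin m → ℕ} {f : (∀ r, Ket (d r)) → ℝ}
    (hf : IsSquareSum a f) : Continuous f := by
  obtain ⟨K, _, p, -, h⟩ := hf
  rw [funext h]
  have := fun k => continuous_eval_coords (p k)
  fun_prop

/-- The factor lost when the expectation of a product of square sums of multidegrees `a t` is
compared with the product of the expectations. -/
noncomputable def momentRatio {T : ℕ} (d : Fin m → ℕ) (a : Fin T → Fin m → ℕ) : ℝ :=
  ∏ r, (∏ t, ((d r).ascFactorial (a t r) : ℝ)) / ((d r).ascFactorial (∑ t, a t r) : ℝ)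

/-- A product of sums of squares is the sum, over choices of one summand per factor, of squares of
product polynomials. Bombieri's inequality applies to each choice; the rising factorials of the two
sides form the ratio. -/
theorem momentRatio_mul_prod_integral_le {T : ℕ} (hd : ∀ r, 0 < d r) (a : Fin T → Fin m → ℕ)
    (f : Fin T → (∀ r, Ket (d r)) → ℝ) (hf : ∀ t, IsSquareSum (a t) (f t)) :
    momentRatio d a * ∏ t, ∫ ψ, f t ψ ∂(Measure.pi fun r => haarKet (d r)) ≤
      ∫ ψ, ∏ t, f t ψ ∂(Measure.pi fun r => haarKet (d r)) := by
  classical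
  set μ := Measure.pi fun r => haarKet (d r)
  choose K hK p hp hfp using hf
  have hasc : ∀ r k, ((d r).ascFactorial k : ℝ) ≠ 0 := fun r k => by
    obtain ⟨e, he⟩ := Nat.exists_eq_succ_of_ne_zero (hd r).ne'
    rw [he]
    exact_mod_cast (Nat.ascFactorial_pos e k).ne'
  have hc := fun (q : MvPolynomial (Σ r, Fin (d r)) ℂ) => continuous_eval_coords q
  have h1 : ∀ t, ∫ ψ, f t ψ ∂μ =
      (∑ k, fockSq (p t k)) / ∏ r, ((d r).ascFactorial (a t r) : ℝ) := by
    intro t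
    simp only [hfp]
    rw [integral_finsetSum _ fun k _ => integrable_pi_haarKet hd (by fun_prop), sum_div]
    exact sum_congr rfl fun k _ => integral_normSq_eval hd (hp t k)
  have h2 : ∫ ψ, ∏ t, f t ψ ∂μ =
      ∑ k : ∀ t, K t, fockSq (∏ t, p t (k t)) /
        ∏ r, ((d r).ascFactorial (∑ t, a t r) : ℝ) := by
    have h3 : ∀ ψ, ∏ t, f t ψ = ∑ k : ∀ t, K t, ‖eval (coords ψ) (∏ t, p t (k t))‖ ^ 2 := by
      intro ψ
      simp only [hfp, prod_univ_sum, Fintype.piFinset_univ, map_prod, norm_prod, prod_pow]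
    simp only [h3]
    rw [integral_finsetSum _ fun k _ => integrable_pi_haarKet hd (by fun_prop)]
    refine sum_congr rfl fun k _ => ?_
    rw [integral_normSq_eval hd (IsWeightedHomogeneous.prod univ (fun t => p t (k t)) a
      fun t _ => hp t (k t))]
    simp
  simp only [h1, h2]
  rw [prod_div_distrib, momentRatio, prod_div_distrib, ← sum_div, prod_comm]
  have hA : ∏ t, ∏ r, ((d r).ascFactorial (a t r) : ℝ) ≠ 0 :=
    prod_ne_zero_iff.2 fun t _ => prod_ne_zero_iff.2 fun r _ => hasc r _
  rw [div_mul_div_comm, mul_comm, mul_div_mul_right _ _ hA]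
  refine div_le_div_of_nonneg_right ?_ (prod_nonneg fun r _ => Nat.cast_nonneg _)
  rw [prod_univ_sum, Fintype.piFinset_univ]
  exact sum_le_sum fun k _ => prod_fockSq_le _ _ a fun t => hp t (k t)

end SquareSums

/-! ### Outcome weights as sums of squares -/

theorem tensor_tensorPow_pureState {m : ℕ} {d : Fin m → ℕ} (a : Fin m → ℕ)
    (ψ : ∀ r, Ket (d r)) :
    (tensor fun r => tensorPow (a r) (pureState (ψ r))) =
      Matrix.vecMulVec (fun w : ∀ r, Fin (a r) → Fin (d r) => ∏ r, ∏ i, coords ψ ⟨r, w r i⟩)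
        (star fun w : ∀ r, Fin (a r) → Fin (d r) => ∏ r, ∏ i, coords ψ ⟨r, w r i⟩) := by
  ext w w'
  simp only [Matrix.vecMulVec_apply, Pi.star_apply, tensor, tensorPow, pureState, Matrix.of_apply,
    Finset.prod_mul_distrib, star_prod]
  rfl

theorem vecMulVec_kronecker_conjTranspose_mul_self {W e : Type*} [Fintype W] [Fintype e]
    (v : W → ℂ) (C : Matrix e e ℂ) :
    Matrix.vecMulVec v (star v) ⊗ₖ (Cᴴ * C) =
      (Matrix.of fun (z : W × e) y => v z.1 * Cᴴ z.2 y) *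
        (Matrix.of fun (z : W × e) y => v z.1 * Cᴴ z.2 y)ᴴ := by
  ext ⟨w, x⟩ ⟨w', x'⟩
  simp only [Matrix.kroneckerMap_apply, Matrix.mul_apply, Matrix.vecMulVec_apply, Pi.star_apply,
    Matrix.conjTranspose_apply, Matrix.of_apply, star_mul', star_star, Finset.mul_sum]
  refine Finset.sum_congr rfl fun y _ => ?_
  ring

theorem trace_conjTranspose_mul_self_mul_conj {n k e : Type*} [Fintype n] [Fintype k] [Fintype e]
    (B : Matrix n n ℂ) (U : Matrix n k ℂ) (V : Matrix k e ℂ) :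
    (Bᴴ * B * (U * (V * Vᴴ) * Uᴴ)).trace = ((B * U * V) * (B * U * V)ᴴ).trace := by
  rw [Matrix.mul_assoc, Matrix.trace_mul_comm]
  simp only [Matrix.conjTranspose_mul, Matrix.mul_assoc]

-- With G = B†B and τ = C†C the trace is a squared Hilbert–Schmidt norm. The matrix in it has
-- entries linear in the amplitudes of ⨂ ψ_r^{⊗ a_r}, which are monomials of multidegree `a`.
open Finset MvPolynomial in
theorem exists_isSquareSum_trace {m : ℕ} {d : Fin m → ℕ} {a : Fin m → ℕ} {n e : Type}
    [Fintype n] [Fintype e] {G : Matrix n n ℂ} (hG : G.PosSemidef) {τ : Matrix e e ℂ}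
    (hτ : τ.PosSemidef) (U : Matrix n ((∀ r, Fin (a r) → Fin (d r)) × e) ℂ) :
    ∃ f : (∀ r, Ket (d r)) → ℝ, IsSquareSum a f ∧ ∀ ψ,
      (G * (U * ((tensor fun r => tensorPow (a r) (pureState (ψ r))) ⊗ₖ τ) * Uᴴ)).trace =
        (f ψ : ℂ) := by
  classical
  obtain ⟨B, rfl⟩ : ∃ B : Matrix n n ℂ, G = Bᴴ * B := by
    open scoped MatrixOrder in
    exact CStarAlgebra.nonneg_iff_eq_star_mul_self.1 hG.nonneg
  obtain ⟨C', rfl⟩ : ∃ C' : Matrix e e ℂ, τ = C'ᴴ * C' := by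
    open scoped MatrixOrder in
    exact CStarAlgebra.nonneg_iff_eq_star_mul_self.1 hτ.nonneg
  let amp : (∀ r, Fin (a r) → Fin (d r)) → MvPolynomial (Σ r, Fin (d r)) ℂ :=
    fun w => ∏ r, ∏ i, X ⟨r, w r i⟩
  let p : n × e → MvPolynomial (Σ r, Fin (d r)) ℂ := fun x =>
    ∑ z, C ((B * U) x.1 z * star (C' x.2 z.2)) * amp z.1
  have hamp : ∀ w, IsWeightedHomogeneous (blockWeight d) (amp w) a := by
    intro w
    have h := IsWeightedHomogeneous.prod univ
      (fun r => ∏ i, (X ⟨r, w r i⟩ : MvPolynomial (Σ r, Fin (d r)) ℂ))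
      (fun r => ∑ i : Fin (a r), blockWeight d ⟨r, w r i⟩)
      fun r _ => IsWeightedHomogeneous.prod univ
        (fun i => (X ⟨r, w r i⟩ : MvPolynomial (Σ r, Fin (d r)) ℂ))
        (fun i => blockWeight d ⟨r, w r i⟩) fun i _ => isWeightedHomogeneous_X _ _ _
    convert h using 1
    funext r
    simp [blockWeight, Finset.sum_apply, Pi.single_apply]
  refine ⟨fun ψ => ∑ x, ‖eval (coords ψ) (p x)‖ ^ 2, ⟨_, inferInstance, p, fun x => ?_,
    fun ψ => rfl⟩, fun ψ => ?_⟩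
  · refine IsWeightedHomogeneous.sum _ _ _ fun z _ => ?_
    have h := (isWeightedHomogeneous_C (blockWeight d)
      ((B * U) x.1 z * star (C' x.2 z.2))).mul (hamp z.1)
    rwa [zero_add] at h
  · rw [tensor_tensorPow_pureState, vecMulVec_kronecker_conjTranspose_mul_self,
      trace_conjTranspose_mul_self_mul_conj, Matrix.trace]
    push_cast
    rw [Fintype.sum_prod_type]
    refine sum_congr rfl fun x _ => ?_
    rw [Matrix.diag_apply, Matrix.mul_apply]
    refine sum_congr rfl fun y _ => ?_
    rw [Matrix.conjTranspose_apply, Complex.star_def, Complex.mul_conj']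
    congr 3
    rw [Matrix.mul_apply]
    simp only [p, amp, map_sum, map_mul, map_prod, eval_C, eval_X, Matrix.of_apply,
      Matrix.conjTranspose_apply]
    refine sum_congr rfl fun z _ => ?_
    ring

namespace Ensemble

variable {m D : ℕ} (E : Ensemble m D)

/-- The `j`-th term of the mixture, without its weight. -/
noncomputable def term (j : Fin E.J) (ψ : ∀ r, Ket (E.d r)) : Matrix (Fin D) (Fin D) ℂ :=
  E.U j * ((tensor fun r => tensorPow (E.a j r) (pureState (ψ r))) ⊗ₖ E.τ j) * (E.U j)ᴴ

theorem state_eq_sum_term (ψ : ∀ r, Ket (E.d r)) :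
    E.state ψ = ∑ j, (E.p j : ℂ) • E.term j ψ := rfl

theorem trace_mul_term {G : Matrix (Fin D) (Fin D) ℂ} (hG : G.PosSemidef) (j : Fin E.J) :
    ∃ f : (∀ r, Ket (E.d r)) → ℝ, IsSquareSum (E.a j) f ∧
      ∀ ψ, (G * E.term j ψ).trace = (f ψ : ℂ) :=
  exists_isSquareSum_trace hG (E.τ_state j).1 (E.U j)

end Ensemble

open Finset

/-! ### The collision bound -/

section MomentRatio

theorem ascFactorial_mul_sub_le (d A b : ℕ) :
    ((d + A).ascFactorial b : ℝ) * (d - A * b) ≤ d * d.ascFactorial b := by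
  induction b with
  | zero => simp
  | succ b ih =>
    rw [Nat.ascFactorial_succ, Nat.ascFactorial_succ]
    push_cast
    have h0 : (0 : ℝ) ≤ (d + A).ascFactorial b := Nat.cast_nonneg _
    have h1 : (0 : ℝ) ≤ d + b := by positivity
    have h2 := mul_le_mul_of_nonneg_left ih h1
    have h3 : ((d : ℝ) + A + b) * (d - A * (b + 1)) ≤ (d + b) * (d - A * b) := by
      -- This is exactly the right side minus the left side, so the sign of d - A b plays no role.
      have : (0 : ℝ) ≤ A * b + A ^ 2 * b + A ^ 2 := by positivity
      nlinarith
    nlinarith [mul_le_mul_of_nonneg_left h3 h0]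

theorem ascFactorial_cast_pos {d : ℕ} (hd : 0 < d) (k : ℕ) : (0 : ℝ) < d.ascFactorial k := by
  obtain ⟨e, rfl⟩ := Nat.exists_eq_succ_of_ne_zero hd.ne'
  exact_mod_cast Nat.ascFactorial_pos e k

/-- Adding a copy of multiplicity a_b to copies of total multiplicity A multiplies the ratio by some
x ≤ 1 with 1 - x ≤ A a_b / d, and such losses add up. -/
theorem prod_ascFactorial_div {ι : Type*} {d : ℕ} (hd : 0 < d) (s : Finset ι) (a : ι → ℕ) :
    (∏ t ∈ s, (d.ascFactorial (a t) : ℝ)) / (d.ascFactorial (∑ t ∈ s, a t) : ℝ) ≤ 1 ∧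
      1 - (∏ t ∈ s, (d.ascFactorial (a t) : ℝ)) / (d.ascFactorial (∑ t ∈ s, a t) : ℝ) ≤
        ((∑ t ∈ s, (a t : ℝ)) ^ 2 - ∑ t ∈ s, (a t : ℝ) ^ 2) / d := by
  classical
  have hd' : (0 : ℝ) < d := by exact_mod_cast hd
  induction s using Finset.induction_on with
  | empty => simp
  | insert b s hb ih =>
    obtain ⟨ih1, ih2⟩ := ih
    rw [prod_insert hb, sum_insert hb, sum_insert hb, sum_insert hb]
    set A := ∑ t ∈ s, a t with hA
    have hAr : ∑ t ∈ s, (a t : ℝ) = A := by rw [hA]; push_cast; rfl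
    rw [hAr] at ih2 ⊢
    set ρ := (∏ t ∈ s, (d.ascFactorial (a t) : ℝ)) / (d.ascFactorial A : ℝ) with hρ
    have hρ0 : 0 ≤ ρ := by positivity
    set x : ℝ := d.ascFactorial (a b) / (d + A).ascFactorial (a b) with hx
    have hpos : (0 : ℝ) < (d + A).ascFactorial (a b) := ascFactorial_cast_pos (by omega) _
    have hx0 : 0 ≤ x := by positivity
    have hx1 : x ≤ 1 := by
      rw [hx, div_le_one hpos]
      rw [Nat.ascFactorial_eq_prod_range, Nat.ascFactorial_eq_prod_range]
      exact_mod_cast prod_le_prod' fun i _ => by omega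
    have hx2 : 1 - x ≤ A * a b / d := by
      rw [hx, one_sub_div hpos.ne', div_le_div_iff₀ hpos hd']
      have := ascFactorial_mul_sub_le d A (a b)
      linarith
    have hfac : (d.ascFactorial (a b) : ℝ) * (∏ t ∈ s, (d.ascFactorial (a t) : ℝ)) /
        (d.ascFactorial (a b + A) : ℝ) = x * ρ := by
      rw [add_comm (a b) A, ← Nat.ascFactorial_mul_ascFactorial, hx, hρ, div_mul_div_comm]
      push_cast
      rw [mul_comm ((d + A).ascFactorial (a b) : ℝ)]
    rw [hfac]
    refine ⟨mul_le_one₀ hx1 hρ0 ih1, ?_⟩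
    have h1 : 1 - x * ρ ≤ (1 - ρ) + (1 - x) := by
      nlinarith [mul_nonneg (sub_nonneg.2 hx1) (sub_nonneg.2 ih1)]
    have h2 : (((a b : ℝ) + A) ^ 2 - ((a b : ℝ) ^ 2 + ∑ t ∈ s, (a t : ℝ) ^ 2)) / d =
        ((A : ℝ) ^ 2 - ∑ t ∈ s, (a t : ℝ) ^ 2) / d + A * a b / d + A * a b / d := by ring
    -- The bound grows by 2 A a_b / d, of which one half is enough.
    have h3 : (0 : ℝ) ≤ A * a b / d := by positivity
    linarith

theorem one_sub_prod_le_sum_one_sub {ι : Type*} (s : Finset ι) (x : ι → ℝ) (h0 : ∀ i, 0 ≤ x i)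
    (h1 : ∀ i, x i ≤ 1) : 1 - ∏ i ∈ s, x i ≤ ∑ i ∈ s, (1 - x i) := by
  classical
  induction s using Finset.induction_on with
  | empty => simp
  | insert b s hb ih =>
    rw [prod_insert hb, sum_insert hb]
    have h2 : ∏ i ∈ s, x i ≤ 1 := prod_le_one (fun i _ => h0 i) fun i _ => h1 i
    nlinarith [mul_nonneg (sub_nonneg.2 (h1 b)) (sub_nonneg.2 h2)]

theorem momentRatio_le_one {m T : ℕ} {d : Fin m → ℕ} (hd : ∀ r, 0 < d r)
    (a : Fin T → Fin m → ℕ) : momentRatio d a ≤ 1 :=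
  prod_le_one (fun _ _ => by positivity) fun r _ =>
    (prod_ascFactorial_div (hd r) univ fun t => a t r).1

theorem one_sub_momentRatio_le {m T : ℕ} {d : Fin m → ℕ} (hd : ∀ r, 0 < d r)
    (a : Fin T → Fin m → ℕ) :
    1 - momentRatio d a ≤
      ∑ r, ((∑ t, (a t r : ℝ)) ^ 2 - ∑ t, (a t r : ℝ) ^ 2) / d r :=
  (one_sub_prod_le_sum_one_sub univ _ (fun _ => by positivity) fun r =>
    (prod_ascFactorial_div (hd r) univ fun t => a t r).1).trans
      (sum_le_sum fun r _ => (prod_ascFactorial_div (hd r) univ fun t => a t r).2)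

/-- The bracket is the sum of x (j t) x (j t') over ordered pairs t ≠ t'. For independent indices of
law `p` each pair has expectation the squared mean; the diagonal, which would bring in second
moments, has cancelled. -/
theorem sum_prod_mul_sq_sub {J T : ℕ} (p x : Fin J → ℝ) (hp : ∑ j, p j = 1) :
    ∑ j : Fin T → Fin J, (∏ t, p (j t)) * ((∑ t, x (j t)) ^ 2 - ∑ t, x (j t) ^ 2) =
      T * (T - 1) * (∑ j, p j * x j) ^ 2 := by
  have h1 : ∀ j : Fin T → Fin J, (∑ t, x (j t)) ^ 2 - ∑ t, x (j t) ^ 2 =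
      ∑ t, ∑ t', if t = t' then 0 else x (j t) * x (j t') := by
    intro j
    rw [sq, sum_mul_sum, ← sum_sub_distrib]
    refine sum_congr rfl fun t _ => ?_
    rw [sub_eq_iff_eq_add, sq]
    rw [← sum_erase_add _ _ (mem_univ t), ← sum_erase_add (a := t) _ _ (mem_univ t)]
    rw [if_pos rfl, add_zero]
    congr 1
    refine sum_congr rfl fun t' ht' => ?_
    rw [if_neg (ne_of_mem_erase ht').symm]
  have h2 : ∀ t t' : Fin T, t ≠ t' →
      ∑ j : Fin T → Fin J, (∏ u, p (j u)) * (x (j t) * x (j t')) = (∑ j, p j * x j) ^ 2 := by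
    intro t t' htt
    have h3 : ∀ j : Fin T → Fin J, (∏ u, p (j u)) * (x (j t) * x (j t')) =
        ∏ u, (p (j u) * ((if u = t then x (j u) else 1) * (if u = t' then x (j u) else 1))) := by
      intro j
      rw [prod_mul_distrib, prod_mul_distrib, prod_ite_eq', prod_ite_eq']
      simp
    rw [sum_congr rfl fun j _ => h3 j, ← Fintype.piFinset_univ,
      ← prod_univ_sum (fun _ => univ)
        (fun u k => p k * ((if u = t then x k else 1) * (if u = t' then x k else 1)))]
    have h4 : ∀ u, ∑ k, p k * ((if u = t then x k else 1) * (if u = t' then x k else 1)) =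
        (if u = t then ∑ j, p j * x j else 1) * (if u = t' then ∑ j, p j * x j else 1) := by
      intro u
      by_cases hu : u = t
      · have : ¬ (u = t') := fun h => htt (hu.symm.trans h)
        simp [hu, htt]
      · by_cases hu' : u = t' <;> simp [hu, hu', hp, htt.symm]
    rw [prod_congr rfl fun u _ => h4 u, prod_mul_distrib, prod_ite_eq', prod_ite_eq']
    simp [sq]
  simp only [h1, mul_sum]
  rw [sum_comm]
  rw [sum_congr rfl fun t _ => sum_comm]
  have h5 : ∀ t t' : Fin T, ∑ j : Fin T → Fin J,
      (∏ u, p (j u)) * (if t = t' then 0 else x (j t) * x (j t')) =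
        (∑ j, p j * x j) ^ 2 - if t = t' then (∑ j, p j * x j) ^ 2 else 0 := by
    intro t t'
    by_cases h : t = t'
    · simp [h]
    · simp only [if_neg h, sub_zero]
      exact h2 t t' h
  simp only [h5, sum_sub_distrib, sum_ite_eq, mem_univ, if_true, sum_const, card_univ,
    Fintype.card_fin, nsmul_eq_mul]
  ring

end MomentRatio

/-! ### Tensor products, positivity and sequential outcomes -/

section Tensor

variable {ι : Type*} [Fintype ι] {n : ι → Type*}

theorem tensor_mul [DecidableEq ι] [∀ i, Fintype (n i)] (A B : ∀ i, Matrix (n i) (n i) ℂ) :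
    tensor A * tensor B = tensor fun i => A i * B i := by
  ext x y
  simp only [Matrix.mul_apply, tensor, Matrix.of_apply, ← prod_mul_distrib]
  rw [prod_univ_sum, Fintype.piFinset_univ]

theorem trace_tensor [DecidableEq ι] [∀ i, Fintype (n i)] (A : ∀ i, Matrix (n i) (n i) ℂ) :
    (tensor A).trace = ∏ i, (A i).trace := by
  simp only [Matrix.trace, tensor, Matrix.diag_apply, Matrix.of_apply]
  rw [prod_univ_sum, Fintype.piFinset_univ]

theorem trace_tensor_mul_tensor [DecidableEq ι] [∀ i, Fintype (n i)]
    (A B : ∀ i, Matrix (n i) (n i) ℂ) :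
    (tensor A * tensor B).trace = ∏ i, (A i * B i).trace := by
  rw [tensor_mul, trace_tensor]

theorem posSemidef_tensor [DecidableEq ι] [∀ i, Fintype (n i)] {A : ∀ i, Matrix (n i) (n i) ℂ}
    (hA : ∀ i, (A i).PosSemidef) : (tensor A).PosSemidef := by
  classical
  have h : ∀ i, ∃ B : Matrix (n i) (n i) ℂ, A i = Bᴴ * B := fun i => by
    open scoped MatrixOrder in
    exact CStarAlgebra.nonneg_iff_eq_star_mul_self.1 (hA i).nonneg
  choose B hB using h
  have : tensor A = (tensor B)ᴴ * tensor B := by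
    have h1 : (tensor B)ᴴ = tensor fun i => (B i)ᴴ := by
      ext x y
      simp [tensor, Matrix.conjTranspose_apply]
    rw [h1, tensor_mul]
    simp only [← hB]
  rw [this]
  exact Matrix.posSemidef_conjTranspose_mul_self _

theorem dotProduct_tensor_mulVec [DecidableEq ι] [∀ i, Fintype (n i)]
    (A : ∀ i, Matrix (n i) (n i) ℂ) (v : ∀ i, n i → ℂ) :
    star (fun x : ∀ i, n i => ∏ i, v i (x i)) ⬝ᵥ
        (tensor A *ᵥ fun x : ∀ i, n i => ∏ i, v i (x i)) =
      ∏ i, star (v i) ⬝ᵥ (A i *ᵥ v i) := by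
  simp only [dotProduct, Matrix.mulVec, tensor, Matrix.of_apply, Pi.star_apply, star_prod,
    ← prod_mul_distrib]
  rw [prod_univ_sum, Fintype.piFinset_univ]
  refine sum_congr rfl fun x _ => ?_
  rw [prod_mul_distrib, prod_univ_sum, Fintype.piFinset_univ]

theorem exists_dotProduct_mulVec_ne_zero {k : Type*} [Fintype k] {A : Matrix k k ℂ}
    (hA : A ≠ 0) : ∃ v : k → ℂ, star v ⬝ᵥ (A *ᵥ v) ≠ 0 := by
  classical
  by_contra! h
  refine hA (Matrix.toEuclideanLin.map_eq_zero_iff.1 ((inner_map_self_eq_zero _).1 fun x => ?_))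
  rw [← inner_conj_symm, EuclideanSpace.inner_eq_star_dotProduct, Matrix.ofLp_toLpLin,
    Matrix.toLin'_apply, dotProduct_comm, h, map_zero]

/-- Over ℂ a real quadratic form comes from a Hermitian matrix: the form of A† - A vanishes, hence
so does A† - A by polarisation. -/
theorem posSemidef_of_dotProduct_nonneg {k : Type*} [Fintype k] {A : Matrix k k ℂ}
    (h : ∀ x : k → ℂ, 0 ≤ star x ⬝ᵥ (A *ᵥ x)) : A.PosSemidef := by
  refine Matrix.PosSemidef.of_dotProduct_mulVec_nonneg ?_ h
  by_contra hA
  obtain ⟨v, hv⟩ := exists_dotProduct_mulVec_ne_zero (sub_ne_zero.2 hA)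
  apply hv
  rw [Matrix.sub_mulVec, dotProduct_sub, sub_eq_zero, Matrix.mulVec_conjTranspose,
    Matrix.star_dotProduct_star, ← Matrix.dotProduct_mulVec]
  exact (IsSelfAdjoint.of_nonneg (h v)).star_eq

/-- A nonzero positive semidefinite tensor product is, up to a positive factor, a tensor product
of positive semidefinite matrices. -/
theorem exists_posSemidef_tensor [DecidableEq ι] [∀ i, Fintype (n i)]
    {A : ∀ i, Matrix (n i) (n i) ℂ} (hA : (tensor A).PosSemidef) :
    ∃ (c : ℝ) (B : ∀ i, Matrix (n i) (n i) ℂ), 0 ≤ c ∧ (∀ i, (B i).PosSemidef) ∧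
      tensor A = (c : ℂ) • tensor B := by
  -- If one factor vanishes, the others are arbitrary and need not be multiples of positive
  -- matrices.
  by_cases h0 : ∃ i, A i = 0
  · obtain ⟨i, hi⟩ := h0
    refine ⟨0, fun _ => 0, le_rfl, fun _ => Matrix.PosSemidef.zero, ?_⟩
    ext x y
    simp [tensor, prod_eq_zero (mem_univ i), hi]
  push Not at h0
  choose v hv using fun i => exists_dotProduct_mulVec_ne_zero (h0 i)
  let c : ι → ℂ := fun i => star (v i) ⬝ᵥ (A i *ᵥ v i)
  have hc : ∀ i, c i ≠ 0 := hv
  have hC : 0 ≤ ∏ i, c i := by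
    have := hA.dotProduct_mulVec_nonneg (fun x => ∏ i, v i (x i))
    rwa [dotProduct_tensor_mulVec] at this
  have hC0 : ∏ i, c i ≠ 0 := prod_ne_zero_iff.2 fun i _ => hc i
  have hCr : ((∏ i, c i).re : ℂ) = ∏ i, c i := (Complex.eq_re_of_ofReal_le hC).symm
  have hCre : 0 < (∏ i, c i).re := by
    refine lt_of_le_of_ne (Complex.le_def.1 hC).1 fun h => hC0 ?_
    rw [← hCr, ← h]; rfl
  -- The factors may carry phases of which only the product is known to be positive. Dividing each
  -- by its own value `c i` removes its phase.
  refine ⟨(∏ i, c i).re, fun i => (c i)⁻¹ • A i, hCre.le, fun i => ?_, ?_⟩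
  · refine posSemidef_of_dotProduct_nonneg fun x => ?_
    -- Testing on the product vector with `x` in slot i isolates the form of `A i`, up to the fixed
    -- values of the other slots.
    have h1 := hA.dotProduct_mulVec_nonneg (fun y => ∏ l, Function.update v i x l (y l))
    rw [dotProduct_tensor_mulVec, ← mul_prod_erase _ _ (mem_univ i)] at h1
    have h2 : ∏ l ∈ univ.erase i, star (Function.update v i x l) ⬝ᵥ
        (A l *ᵥ Function.update v i x l) = ∏ l ∈ univ.erase i, c l :=
      prod_congr rfl fun l hl => by rw [Function.update_of_ne (ne_of_mem_erase hl)]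
    rw [h2, Function.update_self] at h1
    have h3 : star x ⬝ᵥ (((c i)⁻¹ • A i) *ᵥ x) =
        (((∏ i, c i).re)⁻¹ : ℝ) * (star x ⬝ᵥ (A i *ᵥ x) * ∏ l ∈ univ.erase i, c l) := by
      rw [Matrix.smul_mulVec, dotProduct_smul, smul_eq_mul, Complex.ofReal_inv, hCr,
        ← mul_prod_erase _ _ (mem_univ i)]
      have : ∏ l ∈ univ.erase i, c l ≠ 0 := prod_ne_zero_iff.2 fun l _ => hc l
      field_simp [hc i]
    rw [h3]
    exact mul_nonneg (by exact_mod_cast (inv_pos.2 hCre).le) h1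
  · ext x y
    simp only [Matrix.smul_apply, tensor, Matrix.of_apply, smul_eq_mul, hCr, ← prod_mul_distrib]
    exact prod_congr rfl fun i _ => by rw [mul_inv_cancel_left₀ (hc i)]

/-- Summing the probabilities of a sequence of dependent outcomes. -/
theorem sum_prod_dependent {S : Type*} [Fintype S] {T : ℕ}
    (g : ∀ t : Fin T, (Fin t → S) → S → ℂ) (c : Fin T → ℂ) (hg : ∀ t h, ∑ s, g t h s = c t) :
    ∑ s : Fin T → S, ∏ t, g t (fun i => s (Fin.castLE t.isLt.le i)) (s t) = ∏ t, c t := by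
  induction T with
  | zero => simp
  | succ T ih =>
    -- The last outcome is summed first: no other round depends on it, and its sum is the same for
    -- every history.
    rw [← (Fin.snocEquiv fun _ => S).sum_comp, Fintype.sum_prod_type_right, Fin.prod_univ_castSucc,
      ← ih (fun t => g t.castSucc) (fun t => c t.castSucc) fun t h => hg t.castSucc h, sum_mul]
    refine sum_congr rfl fun s _ => ?_
    have h1 : ∀ (x : S) (t : Fin T), g t.castSucc
        (fun i => Fin.snocEquiv (fun _ => S) (x, s) (Fin.castLE t.castSucc.isLt.le i))
        (Fin.snocEquiv (fun _ => S) (x, s) t.castSucc) =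
          g t.castSucc (fun i => s (Fin.castLE t.isLt.le i)) (s t) := by
      intro x t
      have h2 : ∀ i : Fin t, (Fin.castLE t.castSucc.isLt.le i : Fin (T + 1)) =
          (Fin.castLE t.isLt.le i).castSucc := fun i => rfl
      simp only [Fin.snocEquiv_apply]
      congr 1
      · funext i
        exact (congrArg _ (h2 i)).trans (Fin.snoc_castSucc ..)
      · exact Fin.snoc_castSucc ..
    have h3 : ∀ x : S, g (Fin.last T)
        (fun i => Fin.snocEquiv (fun _ => S) (x, s) (Fin.castLE (Fin.last T).isLt.le i))
        (Fin.snocEquiv (fun _ => S) (x, s) (Fin.last T)) = g (Fin.last T) s x := by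
      intro x
      simp only [Fin.snocEquiv_apply]
      congr 1
      · funext i
        exact Fin.snoc_castSucc (α := fun _ => S) x s i
      · exact Fin.snoc_last ..
    simp only [Fin.prod_univ_castSucc, h1, h3, ← mul_sum, hg]
    rfl

end Tensor

/-! ### Expectations over the ensemble and the distance bound -/

theorem trace_mul_integral {Ω n : Type*} [MeasurableSpace Ω] [Fintype n] {μ : Measure Ω}
    (G : Matrix n n ℂ) {A : Ω → Matrix n n ℂ} (hA : ∀ x y, Integrable (fun ω => A ω x y) μ) :
    (G * Matrix.of fun x y => ∫ ω, A ω x y ∂μ).trace = ∫ ω, (G * A ω).trace ∂μ := by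
  simp only [Matrix.trace, Matrix.diag_apply, Matrix.mul_apply, Matrix.of_apply]
  have hG : ∀ x y, Integrable (fun ω => G x y * A ω y x) μ := fun x y => (hA y x).const_mul _
  refine Eq.symm ((integral_finsetSum univ fun x _ => integrable_finsetSum univ
    fun y _ => hG x y).trans (sum_congr rfl fun x _ => ?_))
  exact (integral_finsetSum univ fun y _ => hG x y).trans
    (sum_congr rfl fun y _ => integral_const_mul _ _)

theorem trace_pureState {d : ℕ} (ψ : Ket d) : (pureState ψ).trace = 1 := by
  have h1 : ‖(ψ : EuclideanSpace ℂ (Fin d))‖ ^ 2 = 1 := by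
    rw [norm_eq_of_mem_sphere]; norm_num
  rw [EuclideanSpace.norm_sq_eq] at h1
  simp only [Matrix.trace, Matrix.diag_apply, pureState, Matrix.of_apply, Complex.star_def,
    Complex.mul_conj']
  exact_mod_cast h1

theorem continuous_tensor {X ι : Type*} [TopologicalSpace X] [Fintype ι] {n : ι → Type*}
    {A : ∀ i, X → Matrix (n i) (n i) ℂ} (hA : ∀ i, Continuous (A i)) :
    Continuous fun x => tensor fun i => A i x :=
  continuous_matrix fun _ _ => continuous_finsetProd _ fun i _ => (hA i).matrix_elem _ _

theorem continuous_pureState {d : ℕ} : Continuous (pureState (d := d)) := by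
  refine continuous_matrix fun x y => ?_
  simp only [pureState, Matrix.of_apply]
  fun_prop

theorem continuous_tensor_tensorPow_pureState {m : ℕ} {d : Fin m → ℕ} (a : Fin m → ℕ) :
    Continuous fun ψ : ∀ r, Ket (d r) => tensor fun r => tensorPow (a r) (pureState (ψ r)) := by
  have h : ∀ r, Continuous fun ψ : ∀ r, Ket (d r) => pureState (ψ r) := fun r =>
    continuous_pureState.comp (continuous_apply r)
  have h2 : ∀ r, Continuous fun ψ : ∀ r, Ket (d r) => tensorPow (a r) (pureState (ψ r)) :=
    fun r => continuous_tensor fun _ => h r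
  exact continuous_tensor h2

theorem continuous_conj_kronecker {X n k e : Type*} [TopologicalSpace X] [Fintype k] [Fintype e]
    {A : X → Matrix k k ℂ} (hA : Continuous A) (τ : Matrix e e ℂ) (U : Matrix n (k × e) ℂ) :
    Continuous fun x => U * (A x ⊗ₖ τ) * Uᴴ := by
  refine (continuous_const.matrix_mul (continuous_matrix fun x y => ?_)).matrix_mul continuous_const
  exact (hA.matrix_elem _ _).mul continuous_const

namespace Ensemble

variable {m D : ℕ} (E : Ensemble m D)

theorem continuous_term (j : Fin E.J) : Continuous (E.term j) :=
  continuous_conj_kronecker (continuous_tensor_tensorPow_pureState (E.a j)) (E.τ j) (E.U j)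

theorem continuous_state : Continuous E.state := by
  have := E.continuous_term
  simp only [funext E.state_eq_sum_term]
  fun_prop

theorem continuous_tensorPow_state (T : ℕ) : Continuous fun ψ => tensorPow T (E.state ψ) :=
  continuous_tensor (A := fun (_ : Fin T) ψ => E.state ψ) fun _ => E.continuous_state

theorem integrable {V : Type*} [NormedAddCommGroup V] {f : (∀ r, Ket (E.d r)) → V}
    (hf : Continuous f) : Integrable f E.law :=
  integrable_pi_haarKet E.d_pos hf

instance : IsProbabilityMeasure E.law := isProbabilityMeasure_pi_haarKet E.d_pos

theorem trace_term (j : Fin E.J) (ψ : ∀ r, Ket (E.d r)) : (E.term j ψ).trace = 1 := by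
  rw [term, Matrix.trace_mul_comm, ← Matrix.mul_assoc, E.conjTranspose_mul_U, Matrix.one_mul,
    Matrix.trace_kronecker, trace_tensor, (E.τ_state j).2, mul_one]
  refine prod_eq_one fun r _ => ?_
  rw [tensorPow, trace_tensor]
  exact prod_eq_one fun _ _ => trace_pureState _

theorem trace_state (ψ : ∀ r, Ket (E.d r)) : (E.state ψ).trace = 1 := by
  rw [state_eq_sum_term, Matrix.trace_sum]
  simp only [Matrix.trace_smul, trace_term, smul_eq_mul, mul_one]
  exact_mod_cast E.p_sum

/-- The expectation of the `j`-th term of the mixture. -/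
noncomputable def meanTerm (j : Fin E.J) : Matrix (Fin D) (Fin D) ℂ :=
  Matrix.of fun x y => ∫ ψ, E.term j ψ x y ∂E.law

theorem trace_mul_meanTerm (G : Matrix (Fin D) (Fin D) ℂ) (j : Fin E.J) :
    (G * E.meanTerm j).trace = ∫ ψ, (G * E.term j ψ).trace ∂E.law :=
  trace_mul_integral G fun x y => E.integrable ((E.continuous_term j).matrix_elem x y)

theorem trace_meanTerm (j : Fin E.J) : (E.meanTerm j).trace = 1 := by
  rw [← Matrix.one_mul (E.meanTerm j), trace_mul_meanTerm]
  simp [trace_term]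

theorem mean_eq_sum_meanTerm : E.mean = ∑ j, (E.p j : ℂ) • E.meanTerm j := by
  ext x y
  simp only [mean, meanTerm, Matrix.of_apply, Matrix.sum_apply, Matrix.smul_apply,
    state_eq_sum_term, smul_eq_mul]
  rw [integral_finsetSum _ fun j _ =>
    (E.integrable ((E.continuous_term j).matrix_elem x y)).const_mul _]
  exact sum_congr rfl fun j _ => integral_const_mul _ _

theorem trace_mean : E.mean.trace = 1 := by
  rw [mean_eq_sum_meanTerm, Matrix.trace_sum]
  simp only [Matrix.trace_smul, trace_meanTerm, smul_eq_mul, mul_one]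
  exact_mod_cast E.p_sum

theorem trace_mul_moment {T : ℕ} (F : Matrix (Fin T → Fin D) (Fin T → Fin D) ℂ) :
    (F * E.moment T).trace = ∫ ψ, (F * tensorPow T (E.state ψ)).trace ∂E.law :=
  trace_mul_integral F fun x y =>
    E.integrable ((E.continuous_tensorPow_state T).matrix_elem x y)

theorem trace_moment (T : ℕ) : (E.moment T).trace = 1 := by
  rw [← Matrix.one_mul (E.moment T), trace_mul_moment]
  simp [tensorPow, trace_tensor, trace_state]

theorem trace_tensorPow_mean (T : ℕ) : (tensorPow T E.mean).trace = 1 := by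
  simp [tensorPow, trace_tensor, trace_mean]

/-- Outcome probabilities are defined through real parts; reality of each trace makes their product
agree with the trace of the product. -/
theorem exists_trace_mul_state {G : Matrix (Fin D) (Fin D) ℂ} (hG : G.PosSemidef)
    (ψ : ∀ r, Ket (E.d r)) : ∃ x : ℝ, (G * E.state ψ).trace = x := by
  choose f _ hf using fun j => E.trace_mul_term hG j
  refine ⟨∑ j, E.p j * f j ψ, ?_⟩
  rw [state_eq_sum_term, Matrix.mul_sum, Matrix.trace_sum]
  simp [hf]

theorem exists_trace_mul_mean {G : Matrix (Fin D) (Fin D) ℂ} (hG : G.PosSemidef) :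
    ∃ x : ℝ, (G * E.mean).trace = x := by
  choose f _ hf using fun j => E.trace_mul_term hG j
  refine ⟨∑ j, E.p j * ∫ ψ, f j ψ ∂E.law, ?_⟩
  rw [mean_eq_sum_meanTerm, Matrix.mul_sum, Matrix.trace_sum]
  simp [hf, trace_mul_meanTerm, integral_complex_ofReal]

/-- The probability of an outcome of a product measurement on copies of the average state exceeds
its probability on copies of a random state only by a small amount. -/
theorem exists_trace_sub_trace_le {T : ℕ} {G : Fin T → Matrix (Fin D) (Fin D) ℂ}
    (hG : (tensor G).PosSemidef) :
    ∃ (P Q : ℝ) (w : (Fin T → Fin E.J) → ℝ),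
      (tensor G * E.moment T).trace = P ∧ (tensor G * tensorPow T E.mean).trace = Q ∧
      (∀ j, (tensor G * tensor fun t => E.meanTerm (j t)).trace = w j) ∧ (∀ j, 0 ≤ w j) ∧
      Q - P ≤ ∑ j : Fin T → Fin E.J,
        (∏ t, E.p (j t)) * (1 - momentRatio E.d fun t => E.a (j t)) * w j := by
  obtain ⟨c, B, hc, hB, hcB⟩ := exists_posSemidef_tensor hG
  choose f hfs hf using fun t j => E.trace_mul_term (hB t) j
  have hI : ∀ t j, (B t * E.meanTerm j).trace = ((∫ ψ, f t j ψ ∂E.law : ℝ) : ℂ) := by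
    intro t j
    rw [trace_mul_meanTerm, ← integral_complex_ofReal]
    simp only [hf]
  -- Expanding the mixture in every copy gives a sum over index tuples. The two probabilities differ
  -- only in the order of product and integral; `w` collects the products of integrals.
  refine ⟨c * ∑ j : Fin T → Fin E.J, (∏ t, E.p (j t)) * ∫ ψ, ∏ t, f t (j t) ψ ∂E.law,
    c * ∑ j : Fin T → Fin E.J, (∏ t, E.p (j t)) * ∏ t, ∫ ψ, f t (j t) ψ ∂E.law,
    fun j => c * ∏ t, ∫ ψ, f t (j t) ψ ∂E.law, ?_, ?_, fun j => ?_, fun j => ?_, ?_⟩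
  · have h1 : ∀ ψ, (tensor G * tensorPow T (E.state ψ)).trace =
        ((c * ∑ j : Fin T → Fin E.J, (∏ t, E.p (j t)) * ∏ t, f t (j t) ψ : ℝ) : ℂ) := by
      intro ψ
      rw [hcB, Matrix.smul_mul, Matrix.trace_smul, tensorPow, trace_tensor_mul_tensor, smul_eq_mul]
      push_cast
      congr 1
      simp only [← prod_mul_distrib]
      rw [← Fintype.piFinset_univ, ← prod_univ_sum (fun _ => univ)
        (fun t j => (E.p j : ℂ) * (f t j ψ : ℂ))]
      refine prod_congr rfl fun t _ => ?_
      rw [state_eq_sum_term, Matrix.mul_sum, Matrix.trace_sum]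
      simp [hf]
    have hcont : ∀ t j, Continuous (f t j) := fun t j => (hfs t j).continuous
    rw [trace_mul_moment]
    simp only [h1]
    rw [integral_complex_ofReal, integral_const_mul,
      integral_finsetSum _ fun j _ => E.integrable (by fun_prop)]
    simp only [integral_const_mul]
  · rw [hcB, Matrix.smul_mul, Matrix.trace_smul, tensorPow, trace_tensor_mul_tensor, smul_eq_mul]
    push_cast
    congr 1
    simp only [← prod_mul_distrib]
    rw [← Fintype.piFinset_univ, ← prod_univ_sum (fun _ => univ)
      (fun t j => (E.p j : ℂ) * ((∫ ψ, f t j ψ ∂E.law : ℝ) : ℂ))]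
    refine prod_congr rfl fun t _ => ?_
    rw [mean_eq_sum_meanTerm, Matrix.mul_sum, Matrix.trace_sum]
    simp [hI]
  · rw [hcB, Matrix.smul_mul, Matrix.trace_smul, trace_tensor_mul_tensor, smul_eq_mul]
    simp only [hI]
    push_cast
    rfl
  · exact mul_nonneg hc (prod_nonneg fun t _ => integral_nonneg fun ψ => (hfs t (j t)).nonneg ψ)
  · rw [← mul_sub, ← sum_sub_distrib, mul_sum]
    refine sum_le_sum fun j _ => ?_
    have h1 := momentRatio_mul_prod_integral_le E.d_pos (fun t => E.a (j t))
      (fun t => f t (j t)) fun t => hfs t (j t)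
    have h2 : 0 ≤ c * ∏ t, E.p (j t) := mul_nonneg hc (prod_nonneg fun t _ => E.p_nonneg _)
    have h3 := mul_le_mul_of_nonneg_left h1 h2
    change c * (∏ t, E.p (j t)) * (momentRatio E.d (fun t => E.a (j t)) *
      ∏ t, ∫ ψ, f t (j t) ψ ∂E.law) ≤
        c * (∏ t, E.p (j t)) * ∫ ψ, ∏ t, f t (j t) ψ ∂E.law at h3
    linarith

/-- The distance of `𝔼[σ^{⊗ T}]` and `(𝔼[σ])^{⊗ T}` under product measurements is governed by the
collisions of the Haar-random states in distinct copies. -/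
theorem povmDist_moment_le {T : ℕ} {S : Type*} [Fintype S]
    {F : S → Matrix (Fin T → Fin D) (Fin T → Fin D) ℂ} (hF : IsProductPOVM D T F) :
    povmDist F (E.moment T) (tensorPow T E.mean) ≤
      T * (T - 1) * ∑ r, E.avg r ^ 2 / (E.d r : ℝ) := by
  obtain ⟨⟨hpos, hsum⟩, hprod⟩ := hF
  have hex : ∀ s, ∃ (P Q : ℝ) (w : (Fin T → Fin E.J) → ℝ),
      (F s * E.moment T).trace = P ∧ (F s * tensorPow T E.mean).trace = Q ∧
      (∀ j, (F s * tensor fun t => E.meanTerm (j t)).trace = w j) ∧ (∀ j, 0 ≤ w j) ∧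
      Q - P ≤ ∑ j : Fin T → Fin E.J,
        (∏ t, E.p (j t)) * (1 - momentRatio E.d fun t => E.a (j t)) * w j := by
    intro s
    obtain ⟨G, hG⟩ := hprod s
    rw [hG]
    exact E.exists_trace_sub_trace_le (hG ▸ hpos s)
  choose P Q w hP hQ hw hw0 hle using hex
  have htot : ∀ X : Matrix (Fin T → Fin D) (Fin T → Fin D) ℂ,
      ∑ s, (F s * X).trace = X.trace := by
    intro X
    rw [← Matrix.trace_sum, ← Matrix.sum_mul, hsum, Matrix.one_mul]
  have hPsum : ∑ s, P s = 1 := by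
    have := htot (E.moment T)
    simp only [hP, trace_moment] at this
    exact_mod_cast this
  have hQsum : ∑ s, Q s = 1 := by
    have := htot (tensorPow T E.mean)
    simp only [hQ, trace_tensorPow_mean] at this
    exact_mod_cast this
  have hwsum : ∀ j, ∑ s, w s j = 1 := by
    intro j
    have := htot (tensor fun t => E.meanTerm (j t))
    simp only [hw, trace_tensor, trace_meanTerm, prod_const_one] at this
    exact_mod_cast this
  set ε : (Fin T → Fin E.J) → ℝ := fun j => 1 - momentRatio E.d fun t => E.a (j t) with hε
  have hε0 : ∀ j, 0 ≤ ε j := fun j => sub_nonneg.2 (momentRatio_le_one E.d_pos _)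
  have hp0 : ∀ j : Fin T → Fin E.J, 0 ≤ ∏ t, E.p (j t) :=
    fun j => prod_nonneg fun t _ => E.p_nonneg _
  have hdist : povmDist F (E.moment T) (tensorPow T E.mean) ≤
      ∑ s, ∑ j : Fin T → Fin E.J, (∏ t, E.p (j t)) * ε j * w s j := by
    -- A one-sided bound Q - P ≤ b with b ≥ 0 gives |P - Q| ≤ (P - Q) + 2b, and the sum of P - Q
    -- over all outcomes is zero.
    have h1 : ∀ s, ‖(F s * E.moment T).trace - (F s * tensorPow T E.mean).trace‖ ≤
        (P s - Q s) + 2 * ∑ j : Fin T → Fin E.J, (∏ t, E.p (j t)) * ε j * w s j := by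
      intro s
      have h2 : 0 ≤ ∑ j : Fin T → Fin E.J, (∏ t, E.p (j t)) * ε j * w s j :=
        sum_nonneg fun j _ => mul_nonneg (mul_nonneg (hp0 j) (hε0 j)) (hw0 s j)
      rw [hP, hQ, ← Complex.ofReal_sub, Complex.norm_real, Real.norm_eq_abs]
      have h3 := hle s
      exact abs_le.2 ⟨by linarith, by linarith⟩
    have h2 := sum_le_sum fun s (_ : s ∈ univ) => h1 s
    rw [sum_add_distrib, sum_sub_distrib, hPsum, hQsum, ← mul_sum] at h2
    rw [povmDist]
    linarith
  refine hdist.trans ?_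
  rw [sum_comm]
  simp only [← mul_sum, hwsum, mul_one]
  calc ∑ j : Fin T → Fin E.J, (∏ t, E.p (j t)) * ε j
      ≤ ∑ j : Fin T → Fin E.J, (∏ t, E.p (j t)) *
          ∑ r, ((∑ t, (E.a (j t) r : ℝ)) ^ 2 - ∑ t, (E.a (j t) r : ℝ) ^ 2) / E.d r :=
        sum_le_sum fun j _ =>
          mul_le_mul_of_nonneg_left (one_sub_momentRatio_le E.d_pos _) (hp0 j)
    _ = ∑ r, (∑ j : Fin T → Fin E.J, (∏ t, E.p (j t)) *
          ((∑ t, (E.a (j t) r : ℝ)) ^ 2 - ∑ t, (E.a (j t) r : ℝ) ^ 2)) / E.d r := by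
        simp only [mul_sum, sum_div]
        rw [sum_comm]
        simp only [mul_div_assoc]
    _ = _ := by
        rw [mul_sum]
        refine sum_congr rfl fun r _ => ?_
        rw [sum_prod_mul_sq_sub E.p (fun j => (E.a j r : ℝ)) E.p_sum, mul_div_assoc]
        rfl

theorem avg_nonneg (r : Fin m) : 0 ≤ E.avg r :=
  sum_nonneg fun j _ => mul_nonneg (E.p_nonneg j) (Nat.cast_nonneg _)

theorem avgSq_nonneg (r : Fin m) : 0 ≤ E.avgSq r :=
  sum_nonneg fun j _ => mul_nonneg (E.p_nonneg j) (sq_nonneg _)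

theorem avg_le_aMax (r : Fin m) : E.avg r ≤ E.aMax :=
  le_ciSup (Set.finite_range _).bddAbove r

theorem dMin_le (r : Fin m) : E.dMin ≤ E.d r := ciInf_le (OrderBot.bddBelow _) r

theorem dMin_pos : 0 < E.dMin := by
  have : Nonempty (Fin m) := ⟨⟨0, E.m_pos⟩⟩
  exact (le_ciInf (fun r => E.d_pos r) : 1 ≤ ⨅ r, E.d r)

theorem sum_avg_sq_div_le : ∑ r, E.avg r ^ 2 / (E.d r : ℝ) ≤ m * E.aMax ^ 2 / E.dMin := by
  have h : ∀ r ∈ (univ : Finset (Fin m)), E.avg r ^ 2 / (E.d r : ℝ) ≤ E.aMax ^ 2 / E.dMin := by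
    intro r _
    have h1 : (0 : ℝ) < E.dMin := by exact_mod_cast E.dMin_pos
    have h2 : (E.dMin : ℝ) ≤ E.d r := by exact_mod_cast E.dMin_le r
    exact div_le_div₀ (sq_nonneg _) (pow_le_pow_left₀ (E.avg_nonneg r) (E.avg_le_aMax r) 2) h1 h2
  refine (sum_le_sum h).trans ?_
  simp [mul_div_assoc]

end Ensemble

/-! ### Adaptive protocols and the number of rounds -/

namespace Protocol

variable {D T : ℕ} {S : Type*} [Fintype S] (P : Protocol D T S)

theorem posSemidef_factor (s : Fin T → S) (t : Fin T) : (P.factor s t).PosSemidef :=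
  (P.isPOVM t _).1 _

/-- Completeness is checked entrywise: in a fixed entry it is a sum over dependent outcomes, in
which every round sums to an entry of the identity. -/
theorem isProductPOVM_povm : IsProductPOVM D T P.povm := by
  refine ⟨⟨fun s => posSemidef_tensor (P.posSemidef_factor s), ?_⟩, fun s => ⟨_, rfl⟩⟩
  ext x y
  rw [Matrix.sum_apply]
  have h := sum_prod_dependent (fun t h s => P.F t h s (x t) (y t))
    (fun t => (1 : Matrix (Fin D) (Fin D) ℂ) (x t) (y t)) fun t h => by
      rw [← (P.isPOVM t h).2, Matrix.sum_apply]
  refine h.trans ?_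
  by_cases hxy : x = y
  · subst hxy; simp
  · obtain ⟨t, ht⟩ := Function.ne_iff.1 hxy
    rw [Matrix.one_apply_ne hxy]
    exact prod_eq_zero (mem_univ t) (Matrix.one_apply_ne ht)

theorem outcomeProb_eq {σ : Matrix (Fin D) (Fin D) ℂ}
    (hσ : ∀ G : Matrix (Fin D) (Fin D) ℂ, G.PosSemidef → ∃ x : ℝ, (G * σ).trace = x)
    (s : Fin T → S) : (P.outcomeProb σ s : ℂ) = (P.povm s * tensorPow T σ).trace := by
  rw [povm, tensorPow, trace_tensor_mul_tensor, outcomeProb, Complex.ofReal_prod]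
  refine prod_congr rfl fun t _ => ?_
  obtain ⟨x, hx⟩ := hσ _ (P.posSemidef_factor s t)
  rw [hx, Complex.ofReal_re]

variable {m : ℕ} (E : Ensemble m D)

theorem continuous_outcomeProb_state (s : Fin T → S) :
    Continuous fun ψ => P.outcomeProb (E.state ψ) s := by
  have := E.continuous_state
  refine continuous_finsetProd _ fun t _ => Complex.continuous_re.comp ?_
  exact (continuous_const.matrix_mul this).matrix_trace

theorem integral_outcomeProb_state (s : Fin T → S) :
    ((∫ ψ, P.outcomeProb (E.state ψ) s ∂E.law : ℝ) : ℂ) = (P.povm s * E.moment T).trace := by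
  rw [E.trace_mul_moment, ← integral_complex_ofReal]
  refine integral_congr_ae (Filter.Eventually.of_forall fun ψ => ?_)
  exact P.outcomeProb_eq (fun G hG => E.exists_trace_mul_state hG ψ) s

theorem successProb_le : P.successProb E ≤ 1 / 2 + 1 / 2 *
    povmDist P.povm (E.moment T) (tensorPow T E.mean) := by
  set p : (Fin T → S) → ℝ := fun s => ∫ ψ, P.outcomeProb (E.state ψ) s ∂E.law with hp
  set q : (Fin T → S) → ℝ := fun s => P.outcomeProb E.mean s with hq
  have hpt : ∀ s, (P.povm s * E.moment T).trace = p s :=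
    fun s => (P.integral_outcomeProb_state E s).symm
  have hqt : ∀ s, (P.povm s * tensorPow T E.mean).trace = q s :=
    fun s => (P.outcomeProb_eq (fun G hG => E.exists_trace_mul_mean hG) s).symm
  have htot : ∀ X : Matrix (Fin T → Fin D) (Fin T → Fin D) ℂ,
      ∑ s, (P.povm s * X).trace = X.trace := by
    intro X
    rw [← Matrix.trace_sum, ← Matrix.sum_mul, P.isProductPOVM_povm.1.2, Matrix.one_mul]
  have hpsum : ∑ s, p s = 1 := by
    have := htot (E.moment T)
    simp only [hpt, E.trace_moment] at this
    exact_mod_cast this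
  have hqsum : ∑ s, q s = 1 := by
    have := htot (tensorPow T E.mean)
    simp only [hqt, E.trace_tensorPow_mean] at this
    exact_mod_cast this
  have hint : ∫ ψ, P.acceptProb (E.state ψ) ∂E.law = ∑ s, P.accept s * p s := by
    simp only [acceptProb]
    rw [integral_finsetSum _ fun s _ =>
      (E.integrable (P.continuous_outcomeProb_state E s)).const_mul _]
    simp only [integral_const_mul, hp]
  have hdist : povmDist P.povm (E.moment T) (tensorPow T E.mean) =
      1 / 2 * ∑ s, |p s - q s| := by
    simp only [povmDist, hpt, hqt, ← Complex.ofReal_sub, Complex.norm_real, Real.norm_eq_abs]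
  -- A weight in [0, 1] times x is at most the positive part (|x| + x)/2.
  have hacc : ∑ s, P.accept s * p s - ∑ s, P.accept s * q s ≤
      ∑ s, (1 / 2 * |p s - q s| + 1 / 2 * (p s - q s)) := by
    rw [← sum_sub_distrib]
    refine sum_le_sum fun s _ => ?_
    rw [← mul_sub]
    have h0 := P.accept_nonneg s
    have h1 := P.accept_le_one s
    rcases abs_cases (p s - q s) with ⟨h, h'⟩ | ⟨h, h'⟩ <;> rw [h] <;> nlinarith
  rw [sum_add_distrib, ← mul_sum, ← mul_sum, sum_sub_distrib, hpsum, hqsum, ← hdist] at hacc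
  have hmean : P.acceptProb E.mean = ∑ s, P.accept s * q s := rfl
  rw [successProb, hint, hmean]
  linarith

theorem le_of_le_successProb (hT : 0 < T) {δ : ℝ} (hδ : 0 < δ)
    (h : 1 / 2 + δ ≤ P.successProb E) :
    0 < E.aMax ∧ √δ * √((E.dMin : ℝ) / ((m : ℝ) * E.aMax ^ 2)) ≤ (T : ℝ) := by
  have h1 := P.successProb_le E
  have h2 := E.povmDist_moment_le P.isProductPOVM_povm
  have hT1 : (1 : ℝ) ≤ T := by exact_mod_cast hT
  have hd : (0 : ℝ) < E.dMin := by exact_mod_cast E.dMin_pos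
  have hm : (0 : ℝ) < m := by exact_mod_cast E.m_pos
  have h3 : (T : ℝ) * (T - 1) * ∑ r, E.avg r ^ 2 / (E.d r : ℝ) ≤
      T ^ 2 * (m * E.aMax ^ 2 / E.dMin) := by
    refine mul_le_mul (by nlinarith) E.sum_avg_sq_div_le
      (sum_nonneg fun r _ => by positivity) (by positivity)
  have h4 : δ ≤ T ^ 2 * (m * E.aMax ^ 2 / E.dMin) := by linarith
  have ha0 : 0 ≤ E.aMax := (E.avg_nonneg ⟨0, E.m_pos⟩).trans (E.avg_le_aMax _)
  -- With a_max = 0 the bound `h4` would read δ ≤ 0. This must be excluded separately, since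
  -- division by zero would make the bound on T empty.
  have ha : 0 < E.aMax := by
    refine lt_of_le_of_ne ha0 fun h5 => ?_
    rw [← h5] at h4
    norm_num at h4
    linarith
  refine ⟨ha, ?_⟩
  rw [← Real.sqrt_mul hδ.le]
  refine Real.sqrt_le_iff.2 ⟨by positivity, ?_⟩
  rw [mul_div_assoc', div_le_iff₀ (by positivity)]
  rw [mul_div_assoc', le_div_iff₀ hd] at h4
  exact h4

end Protocol

end HaarAssembled

theorem theorem4p2 :
    (∀ (m D T : ℕ) (_ : 0 < T) (E : HaarAssembled.Ensemble m D),
      -- the total variation bound for all product POVMs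
      (∀ (S : Type) [Fintype S] (F : S → Matrix (Fin T → Fin D) (Fin T → Fin D) ℂ),
        HaarAssembled.IsProductPOVM D T F →
          HaarAssembled.povmDist F (E.moment T) (HaarAssembled.tensorPow T E.mean) ≤
            (T : ℝ) * ((T : ℝ) - 1) * ∑ r, E.avg r ^ 2 / (E.d r : ℝ) +
              (T : ℝ) * ∑ r, E.avgSq r / (E.d r : ℝ)) ∧
      -- protocols are limited by the distance for their product POVM
      (∀ (S : Type) [Fintype S] (P : HaarAssembled.Protocol D T S),
        HaarAssembled.IsProductPOVM D T P.povm ∧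
          P.successProb E ≤ 1 / 2 + 1 / 2 *
            HaarAssembled.povmDist P.povm (E.moment T) (HaarAssembled.tensorPow T E.mean))) ∧
    -- the number of samples needed for a constant advantage over guessing
    (∀ δ : ℝ, 0 < δ → ∃ c : ℝ, 0 < c ∧
      ∀ (m D T : ℕ) (_ : 0 < T) (E : HaarAssembled.Ensemble m D)
        (S : Type) [Fintype S] (P : HaarAssembled.Protocol D T S),
        1 / 2 + δ ≤ P.successProb E →
          0 < E.aMax ∧ c * √((E.dMin : ℝ) / ((m : ℝ) * E.aMax ^ 2)) ≤ (T : ℝ)) := by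
  refine ⟨fun m D T _ E => ⟨fun S _ F hF => ?_, fun S _ P =>
    ⟨P.isProductPOVM_povm, P.successProb_le E⟩⟩, fun δ hδ =>
    ⟨√δ, Real.sqrt_pos.2 hδ, fun m D T hT E S _ P h => P.le_of_le_successProb E hT hδ h⟩⟩
  -- The collision bound is already stronger; the second summand only has to be nonnegative.
  refine (E.povmDist_moment_le hF).trans (le_add_of_nonneg_right ?_)
  exact mul_nonneg (Nat.cast_nonneg T) (Finset.sum_nonneg fun r _ =>
    div_nonneg (E.avgSq_nonneg r) (Nat.cast_nonneg _))
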